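/- Let $d,N\ge 1$, let $\Omega\subset\mathbb R^d$ be a bounded nonempty Lipschitz open set, partitioned up to a null set into pairwise disjoint connected Lipschitz open sets $\Omega_1,\dots,\Omega_N$; write $I=\{1,\dots,N\}$, and assume that for every $A\subset I$ the interior of $\bigcup_{i\in A}\overline{\Omega_i}$ is a Lipschitz open set. For $S\subset I$ put $\Omega_S=\bigcup_{i\in S}\Omega_i$. For disjoint $S,K\subset I$ let $V_{S,K}=H^1_0(\Omega\setminus\Omega_S;\Omega_K^{\rm const})\cap H^1(\Omega_S)$ be the space of functions $v$ that are $H^1$ in the interior of $\Omega\setminus\Omega_S$ and in each $\Omega_i$, $i\in S$ (jumps across $\partial\Omega_i$, $i\in S$, being allowed), that vanish on $\partial\Omega$, and that are equal to a constant $C_i$ in $\Omega_i$ for each $i\in K$. Let $J=I_{0,H^1}\subset I$ and let $\mathcal H=V_{J,\emptyset}$, with $\|v\|_{\mathcal H}^2=\sum_{i\in I}\int_{\Omega_i}|\nabla v|^2+v^2\,dx$. Let $e:\mathcal H\to\mathbb R$ be $C^2$ near a point $u\in\mathcal H$, let $\kappa>0$, and assume that with some $m>0$ and $M$ $$|e''(u;v,w)|\le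 M\|v\|_{\mathcal H}\|w\|_{\mathcal H},\qquad e''(u;v,v)\ge m\|v\|_{\mathcal H}^2\qquad\text{for all } v,w\in\mathcal H.$$ Assume that $J$ is exactly the set of those $i\in I$ for which the $L^2$ representation $g_0$ of $e'(u;\cdot)$ is, in $\Omega_i$, an $H^1$ function vanishing on $\partial\Omega$: that is, there is $g_0\in H^1(\Omega_i)$ with $g_0=0$ on $\partial\Omega\cap\partial\Omega_i$ and $e'(u;\varphi)=\int_{\Omega_i}g_0\varphi\,dx$ for all $\varphi\in C_c^\infty(\Omega_i)$. Assume moreover that for $i\in J$ this representation $e'(u;v)=\int_{\Omega_i}g_0v\,dx$ holds for all $v\in\mathcal H$ vanishing outside $\Omega_i$. Let $\Lambda^+=(0,\infty)^N$ and let $\partial\Lambda^+$ be its boundary in $[0,\infty]^N$. For $\lambda\in\partial\Lambda^+$ let $I_{0,\lambda}=\{i:\lambda_i=0\}$ and $I_{\infty,\lambda}=\{i:\lambda_i=\infty\}$. Then: (a) For every $\lambda\in\partial\Lambda^+$ with $I_{0,\lambda}\subset I_{0,H^1}$ there is exactly one $g(\lambda)\in V_\lambda:=V_{I_{0,\lambda},I_{\infty,\lambda}}$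 such that, with $\Omega_{0,\lambda}=\Omega_{I_{0,\lambda}}$, $$\int_{\Omega\setminus\Omega_{0,\lambda}}\lambda\,\nabla g(\lambda)\cdot\nabla v+g(\lambda)v\,dx+\int_{\Omega_{0,\lambda}}g(\lambda)v\,dx=e'(u;v)\qquad\text{for all } v\in V_\lambda,$$ where $\lambda\,\nabla g(\lambda)\cdot\nabla v$ is read as $0$ in the cells with $\lambda_i=\infty$ (there $g(\lambda)$ and $v$ are constant). (b) Let $f(g)=\frac{\kappa}{2}e''(u;g,g)-e'(u;g)$ and $j(\lambda)=f(g(\lambda))$. The minimization problem $$\min\{\,j(\lambda):\ \lambda\in\partial\Lambda^+,\ I_{0,\lambda}\subset I_{0,H^1}\,\}$$ has a solution $\widehat\lambda$. -/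

import Mathlib

open MeasureTheory Set
open scoped ENNReal NNReal ContDiff InnerProductSpace

noncomputable section

/-- The Euclidean space `ℝ^d`. -/
abbrev Eu (d : ℕ) : Type := EuclideanSpace ℝ (Fin d)

/-! ### Geometry -/

/-- A Lipschitz open set: near each of its boundary points it is the set of points strictly on
one side of the graph of a Lipschitz function over the hyperplane orthogonal to a unit vector
`a`. -/
def IsLipschitzOpen {d : ℕ} (U : Set (Eu d)) : Prop :=
  IsOpen U ∧ ∀ p ∈ frontier U, ∃ r : ℝ, 0 < r ∧ ∃ a : Eu d, ‖a‖ = 1 ∧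
    ∃ (K : ℝ≥0) (ψ : Eu d → ℝ), LipschitzWith K ψ ∧
      ∀ x ∈ Metric.ball p r, (x ∈ U ↔ ψ (x - ⟪a, x⟫_ℝ • a) < ⟪a, x⟫_ℝ)

/-- `Ω` is a bounded nonempty Lipschitz open set, partitioned (up to a null set) into finitely
many connected Lipschitz open sets `cell i`, such that the union of any of the cells (with the
interfaces between them) is again a Lipschitz open set. -/
structure IsLipschitzPartition {d N : ℕ} (Ω : Set (Eu d)) (cell : Fin N → Set (Eu d)) : Prop where
  bounded : Bornology.IsBounded Ω
  nonempty : Ω.Nonempty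
  lipschitz : IsLipschitzOpen Ω
  cell_lipschitz : ∀ i, IsLipschitzOpen (cell i)
  cell_connected : ∀ i, IsConnected (cell i)
  cell_subset : ∀ i, cell i ⊆ Ω
  cell_disjoint : ∀ i j, i ≠ j → Disjoint (cell i) (cell j)
  cover : volume (Ω \ ⋃ i, cell i) = 0
  union_lipschitz : ∀ A : Set (Fin N), IsLipschitzOpen (interior (⋃ i ∈ A, closure (cell i)))

/-! ### Broken Sobolev spaces -/

/-- `G` is the weak gradient of `v` on the open set `U`. -/
def IsWeakGradOn {d : ℕ} (U : Set (Eu d)) (v : Eu d → ℝ) (G : Eu d → Eu d) : Prop :=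
  ∀ φ : Eu d → ℝ, ContDiff ℝ ∞ φ → HasCompactSupport φ → tsupport φ ⊆ U →
    ∀ a : Eu d, ∫ x, v x * fderiv ℝ φ x a = - ∫ x, ⟪G x, a⟫_ℝ * φ x

/-- Pairs (function, gradient field) of square integrable functions on `ℝ^d`, with the norm
`(‖v‖² + ‖G‖²)^{1/2}` and the corresponding inner product. -/
abbrev FunGrad (d : ℕ) : Type :=
  WithLp 2 (Lp ℝ 2 (volume : Measure (Eu d)) × Lp (Eu d) 2 (volume : Measure (Eu d)))

/-- The complement of the closed cells with index outside `A`: it consists of the cells with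
index in `A`, the interfaces between them, the exterior of `Ω`, and the part of `∂Ω` that is not
reached by the other cells. A function vanishing outside `Ω` is weakly differentiable there iff it
is weakly differentiable in the union of the cells with index in `A` and vanishes on `∂Ω`. -/
def awayFrom {d N : ℕ} (cell : Fin N → Set (Eu d)) (A : Set (Fin N)) : Set (Eu d) :=
  (⋃ j ∈ Aᶜ, closure (cell j))ᶜ

theorem awayFrom_mono {d N : ℕ} (cell : Fin N → Set (Eu d)) {A B : Set (Fin N)} (h : A ⊆ B) :
    awayFrom cell A ⊆ awayFrom cell B :=
  compl_subset_compl.2 (biUnion_subset_biUnion_left (compl_subset_compl.2 h))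

theorem integrable_mul_of_lp {d : ℕ} (f : Lp ℝ 2 (volume : Measure (Eu d))) {g : Eu d → ℝ}
    (hg : Continuous g) (hc : HasCompactSupport g) : Integrable (fun x => f x * g x) :=
  (Lp.memLp f).integrable_mul (q := 2) (hg.memLp_of_hasCompactSupport hc)

theorem integrable_inner_mul_of_lp {d : ℕ} (f : Lp (Eu d) 2 (volume : Measure (Eu d)))
    {g : Eu d → ℝ} (hg : Continuous g) (hc : HasCompactSupport g) (a : Eu d) :
    Integrable (fun x => ⟪f x, a⟫_ℝ * g x) :=
  ((Lp.memLp f).inner_const a).integrable_mul (q := 2) (hg.memLp_of_hasCompactSupport hc)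

theorem isWeakGradOn_zero {d : ℕ} (U : Set (Eu d)) :
    IsWeakGradOn U (0 : FunGrad d).fst (0 : FunGrad d).snd := by
  intro φ _ _ _ a
  have h1 : (fun x => ((0 : FunGrad d).fst : Eu d → ℝ) x * fderiv ℝ φ x a) =ᵐ[volume] 0 := by
    filter_upwards [Lp.coeFn_zero ℝ 2 (volume : Measure (Eu d))] with x hx
    simp only [WithLp.zero_fst, hx, Pi.zero_apply, zero_mul]
  have h2 : (fun x => ⟪((0 : FunGrad d).snd : Eu d → Eu d) x, a⟫_ℝ * φ x) =ᵐ[volume] 0 := by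
    filter_upwards [Lp.coeFn_zero (Eu d) 2 (volume : Measure (Eu d))] with x hx
    simp only [WithLp.zero_snd, hx, Pi.zero_apply, inner_zero_left, zero_mul]
  rw [integral_congr_ae h1, integral_congr_ae h2]
  simp

theorem IsWeakGradOn.add {d : ℕ} {U : Set (Eu d)} {p q : FunGrad d}
    (hp : IsWeakGradOn U p.fst p.snd) (hq : IsWeakGradOn U q.fst q.snd) :
    IsWeakGradOn U (p + q).fst (p + q).snd := by
  intro φ h1 h2 h3 a
  have hd : Continuous (fun x => fderiv ℝ φ x a) :=
    (h1.continuous_fderiv (by simp)).clm_apply continuous_const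
  have hdc : HasCompactSupport (fun x => fderiv ℝ φ x a) := h2.fderiv_apply ℝ a
  have e1 : (fun x => ((p + q).fst : Eu d → ℝ) x * fderiv ℝ φ x a) =ᵐ[volume]
      fun x => p.fst x * fderiv ℝ φ x a + q.fst x * fderiv ℝ φ x a := by
    filter_upwards [Lp.coeFn_add p.fst q.fst] with x hx
    rw [WithLp.add_fst, hx, Pi.add_apply, add_mul]
  have e2 : (fun x => ⟪((p + q).snd : Eu d → Eu d) x, a⟫_ℝ * φ x) =ᵐ[volume]
      fun x => ⟪p.snd x, a⟫_ℝ * φ x + ⟪q.snd x, a⟫_ℝ * φ x := by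
    filter_upwards [Lp.coeFn_add p.snd q.snd] with x hx
    rw [WithLp.add_snd, hx, Pi.add_apply, inner_add_left, add_mul]
  rw [integral_congr_ae e1, integral_congr_ae e2,
    integral_add (integrable_mul_of_lp _ hd hdc) (integrable_mul_of_lp _ hd hdc),
    integral_add (integrable_inner_mul_of_lp _ h1.continuous h2 a)
      (integrable_inner_mul_of_lp _ h1.continuous h2 a), hp φ h1 h2 h3 a, hq φ h1 h2 h3 a]
  ring

theorem IsWeakGradOn.smul {d : ℕ} {U : Set (Eu d)} {p : FunGrad d} (c : ℝ)
    (hp : IsWeakGradOn U p.fst p.snd) : IsWeakGradOn U (c • p).fst (c • p).snd := by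
  intro φ h1 h2 h3 a
  have e1 : (fun x => ((c • p).fst : Eu d → ℝ) x * fderiv ℝ φ x a) =ᵐ[volume]
      fun x => c * (p.fst x * fderiv ℝ φ x a) := by
    filter_upwards [Lp.coeFn_smul c p.fst] with x hx
    rw [WithLp.smul_fst, hx, Pi.smul_apply, smul_eq_mul, mul_assoc]
  have e2 : (fun x => ⟪((c • p).snd : Eu d → Eu d) x, a⟫_ℝ * φ x) =ᵐ[volume]
      fun x => c * (⟪p.snd x, a⟫_ℝ * φ x) := by
    filter_upwards [Lp.coeFn_smul c p.snd] with x hx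
    rw [WithLp.smul_snd, hx, Pi.smul_apply, real_inner_smul_left, mul_assoc]
  rw [integral_congr_ae e1, integral_congr_ae e2, integral_const_mul, integral_const_mul,
    hp φ h1 h2 h3 a]
  ring

/-- For disjoint sets of indices `S` and `K`, with `Ω_S = ⋃ i ∈ S, cell i` and
`Ω_K = ⋃ i ∈ K, cell i`, the space `H¹₀(Ω ∖ Ω_S; Ω_K^const) ∩ H¹(Ω_S)`:
functions that are `H¹` in `Ω ∖ Ω_S` and in each cell of `Ω_S` (with possible jumps across the
boundaries of the cells of `Ω_S`), vanish on `∂Ω`, and are constant on each cell of `Ω_K`.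
An element is given together with its gradient, computed cell by cell; both are extended by zero.
The norm is `(∑ i, ∫_{cell i} |∇v|² + v²)^{1/2}`. -/
def brokenSobolev {d N : ℕ} (Ω : Set (Eu d)) (cell : Fin N → Set (Eu d)) (S K : Set (Fin N)) :
    Submodule ℝ (FunGrad d) where
  carrier := {p |
    (∀ᵐ x, x ∉ Ω → p.fst x = 0) ∧
    (∀ᵐ x, x ∉ (⋃ i, cell i) → p.snd x = 0) ∧
    IsWeakGradOn (awayFrom cell Sᶜ) p.fst p.snd ∧
    (∀ i ∈ S, IsWeakGradOn (awayFrom cell {i}) p.fst p.snd) ∧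
    (∀ i ∈ K, ∃ C : ℝ, ∀ᵐ x, x ∈ cell i → p.fst x = C)}
  zero_mem' := by
    refine ⟨?_, ?_, isWeakGradOn_zero _, fun i _ => isWeakGradOn_zero _, fun i _ => ⟨0, ?_⟩⟩
    · filter_upwards [Lp.coeFn_zero ℝ 2 (volume : Measure (Eu d))] with x hx _
      rw [WithLp.zero_fst, hx, Pi.zero_apply]
    · filter_upwards [Lp.coeFn_zero (Eu d) 2 (volume : Measure (Eu d))] with x hx _
      rw [WithLp.zero_snd, hx, Pi.zero_apply]
    · filter_upwards [Lp.coeFn_zero ℝ 2 (volume : Measure (Eu d))] with x hx _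
      rw [WithLp.zero_fst, hx, Pi.zero_apply]
  add_mem' := by
    rintro p q ⟨p1, p2, p3, p4, p5⟩ ⟨q1, q2, q3, q4, q5⟩
    refine ⟨?_, ?_, p3.add q3, fun i hi => (p4 i hi).add (q4 i hi), fun i hi => ?_⟩
    · filter_upwards [Lp.coeFn_add p.fst q.fst, p1, q1] with x hx h1 h2 h
      rw [WithLp.add_fst, hx, Pi.add_apply, h1 h, h2 h, add_zero]
    · filter_upwards [Lp.coeFn_add p.snd q.snd, p2, q2] with x hx h1 h2 h
      rw [WithLp.add_snd, hx, Pi.add_apply, h1 h, h2 h, add_zero]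
    · obtain ⟨C, hC⟩ := p5 i hi
      obtain ⟨D, hD⟩ := q5 i hi
      refine ⟨C + D, ?_⟩
      filter_upwards [Lp.coeFn_add p.fst q.fst, hC, hD] with x hx h1 h2 h
      rw [WithLp.add_fst, hx, Pi.add_apply, h1 h, h2 h]
  smul_mem' := by
    rintro c p ⟨p1, p2, p3, p4, p5⟩
    refine ⟨?_, ?_, p3.smul c, fun i hi => (p4 i hi).smul c, fun i hi => ?_⟩
    · filter_upwards [Lp.coeFn_smul c p.fst, p1] with x hx h1 h
      rw [WithLp.smul_fst, hx, Pi.smul_apply, h1 h, smul_zero]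
    · filter_upwards [Lp.coeFn_smul c p.snd, p2] with x hx h1 h
      rw [WithLp.smul_snd, hx, Pi.smul_apply, h1 h, smul_zero]
    · obtain ⟨C, hC⟩ := p5 i hi
      refine ⟨c * C, ?_⟩
      filter_upwards [Lp.coeFn_smul c p.fst, hC] with x hx h1 h
      rw [WithLp.smul_fst, hx, Pi.smul_apply, h1 h, smul_eq_mul]

/-- The spaces increase when more cells are broken off and when fewer constants are imposed; in
particular all of them with `S ⊆ J` are contained in `brokenSobolev Ω cell J ∅`. -/
theorem brokenSobolev_mono {d N : ℕ} (Ω : Set (Eu d)) (cell : Fin N → Set (Eu d))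
    {S J K K' : Set (Fin N)} (hS : S ⊆ J) (hK : K' ⊆ K) :
    brokenSobolev Ω cell S K ≤ brokenSobolev Ω cell J K' := by
  rintro p ⟨p1, p2, p3, p4, p5⟩
  refine ⟨p1, p2, fun φ h1 h2 h3 => p3 φ h1 h2 (h3.trans (awayFrom_mono _ ?_)), fun i hi => ?_,
    fun i hi => p5 i (hK hi)⟩
  · exact compl_subset_compl.2 hS
  · by_cases h : i ∈ S
    · exact p4 i h
    · exact fun φ h1 h2 h3 => p3 φ h1 h2 (h3.trans (awayFrom_mono _ (singleton_subset_iff.2 h)))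

/-- The Hilbert space `𝓗`: functions that are `H¹` in `Ω ∖ Ω_J` and in each cell of `Ω_J` and
that vanish on `∂Ω`, with the norm `(∑ i, ∫_{cell i} |∇v|² + v²)^{1/2}`. -/
abbrev BrokenH {d N : ℕ} (Ω : Set (Eu d)) (cell : Fin N → Set (Eu d)) (J : Set (Fin N)) : Type :=
  ↥(brokenSobolev Ω cell J ∅)

/-- Functions in `H¹(cell i)` vanishing on `∂Ω` (not on the rest of the boundary of the cell),
extended by zero, together with their gradients. -/
def cellSobolev {d N : ℕ} (cell : Fin N → Set (Eu d)) (i : Fin N) : Set (FunGrad d) :=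
  {w | (∀ᵐ x, x ∉ cell i → w.fst x = 0) ∧ (∀ᵐ x, x ∉ cell i → w.snd x = 0) ∧
    IsWeakGradOn (awayFrom cell {i}) w.fst w.snd}

/-! ### The `L²` representation of a functional -/

/-- `w` is the `L²` representation of the functional `L` in the sense of distributions in
`cell i`: `L φ = ∫_{cell i} w φ` for all test functions `φ` in `cell i`. -/
def RepresentsInDistributions {d N : ℕ} {Ω : Set (Eu d)} {cell : Fin N → Set (Eu d)}
    {J : Set (Fin N)} (L : BrokenH Ω cell J → ℝ) (i : Fin N) (w : FunGrad d) : Prop :=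
  ∀ v : BrokenH Ω cell J,
    (∃ φ : Eu d → ℝ, ContDiff ℝ ∞ φ ∧ HasCompactSupport φ ∧ tsupport φ ⊆ cell i ∧
      (v : FunGrad d).fst =ᵐ[volume] φ) →
    L v = ∫ x in cell i, w.fst x * (v : FunGrad d).fst x

/-- `L v = ∫_{cell i} w v` for all `v ∈ 𝓗` that vanish outside `cell i`. -/
def RepresentsOnCell {d N : ℕ} {Ω : Set (Eu d)} {cell : Fin N → Set (Eu d)}
    {J : Set (Fin N)} (L : BrokenH Ω cell J → ℝ) (i : Fin N) (w : FunGrad d) : Prop :=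
  ∀ v : BrokenH Ω cell J, (∀ᵐ x, x ∉ cell i → (v : FunGrad d).fst x = 0) →
    L v = ∫ x in cell i, w.fst x * (v : FunGrad d).fst x

/-- The set of indices of the cells in which the `L²` representation `g₀` of `L` (in the sense of
distributions) is an `H¹` function vanishing on `∂Ω`. -/
def h1Cells {d N : ℕ} {Ω : Set (Eu d)} {cell : Fin N → Set (Eu d)}
    {J : Set (Fin N)} (L : BrokenH Ω cell J → ℝ) : Set (Fin N) :=
  {i | ∃ w ∈ cellSobolev cell i, RepresentsInDistributions L i w}

/-! ### Weights and degenerate gradients -/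

/-- The positive finite weights `Λ⁺ = (0,∞)^N`, inside `[0,∞]^N`. -/
def posWeights (N : ℕ) : Set (Fin N → ℝ≥0∞) := {l | ∀ i, 0 < l i ∧ l i < ⊤}

/-- `I_{0,λ}`, the indices with weight zero. -/
def zeroSet {N : ℕ} (l : Fin N → ℝ≥0∞) : Set (Fin N) := {i | l i = 0}

/-- `I_{∞,λ}`, the indices with infinite weight. -/
def inftySet {N : ℕ} (l : Fin N → ℝ≥0∞) : Set (Fin N) := {i | l i = ⊤}

/-- The boundary weights `λ ∈ ∂Λ⁺` (boundary in `[0,∞]^N`) with `I_{0,λ} ⊆ J`. -/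
def boundaryWeights {N : ℕ} (J : Set (Fin N)) : Set (Fin N → ℝ≥0∞) :=
  {l | l ∈ frontier (posWeights N) ∧ zeroSet l ⊆ J}

/-- `∫_{Ω∖Ω_{0,λ}} (λ ∇p·∇q + p q) + ∫_{Ω_{0,λ}} p q`. In the cells with infinite weight the
functions are constant and `λ ∇p·∇q` is read as zero, in accordance with `(⊤ : ℝ≥0∞).toReal = 0`. -/
def weightedForm {d N : ℕ} (Ω : Set (Eu d)) (cell : Fin N → Set (Eu d)) (l : Fin N → ℝ≥0∞)
    (p q : FunGrad d) : ℝ :=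
  (∑ i, (l i).toReal * ∫ x in cell i, ⟪p.snd x, q.snd x⟫_ℝ) + ∫ x in Ω, p.fst x * q.fst x

/-- `g` is the degenerate gradient `g(λ)` of `L = e'(u;·)`:
`g ∈ V_λ := H¹₀(Ω∖Ω_{0,λ}; Ω_{∞,λ}^const) ∩ H¹(Ω_{0,λ})`, and the weighted form of `g` and `v`
is `L v` for all `v ∈ V_λ`. When `I_{0,λ} ⊆ J`, as in all uses below, `V_λ ⊆ 𝓗`. -/
def IsDegenerateGradient {d N : ℕ} {Ω : Set (Eu d)} {cell : Fin N → Set (Eu d)}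
    {J : Set (Fin N)} (L : BrokenH Ω cell J → ℝ) (l : Fin N → ℝ≥0∞) (g : BrokenH Ω cell J) : Prop :=
  (g : FunGrad d) ∈ brokenSobolev Ω cell (zeroSet l) (inftySet l) ∧
  ∀ v : BrokenH Ω cell J, (v : FunGrad d) ∈ brokenSobolev Ω cell (zeroSet l) (inftySet l) →
    weightedForm Ω cell l g v = L v

/-- `g(λ)` (an arbitrary element of `𝓗` if there is no degenerate gradient). -/
def degenerateGradient {d N : ℕ} {Ω : Set (Eu d)} {cell : Fin N → Set (Eu d)}
    {J : Set (Fin N)} (L : BrokenH Ω cell J → ℝ) (l : Fin N → ℝ≥0∞) : BrokenH Ω cell J :=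
  Classical.epsilon (IsDegenerateGradient L l)

/-- `f(g) = (κ/2) e''(u;g,g) - e'(u;g)`. -/
def quadModel {H : Type*} [NormedAddCommGroup H] [NormedSpace ℝ H] (κ : ℝ) (e : H → ℝ) (u g : H) :
    ℝ :=
  κ / 2 * fderiv ℝ (fderiv ℝ e) u g g - fderiv ℝ e u g

/-- `j(λ) = f(g(λ))`. -/
def weightCost {d N : ℕ} {Ω : Set (Eu d)} {cell : Fin N → Set (Eu d)} {J : Set (Fin N)}
    (κ : ℝ) (e : BrokenH Ω cell J → ℝ) (u : BrokenH Ω cell J) (l : Fin N → ℝ≥0∞) : ℝ :=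
  quadModel κ e u (degenerateGradient (fderiv ℝ e u) l)

end

/-!
Write `L = e'(u;·)`. Existence of the degenerate gradient `g(λ)` is Lax–Milgram
(`exists_forall_weighted_eq`), except that the form has no gradient term in the cells of weight
zero. There `L` is represented by an `H¹` function `w`, because `I_{0,λ} ⊆ J`; subtracting
`∫ w v` over those cells from the right-hand side makes the solution of a coercive auxiliary
problem free of energy there, and adding `w` back gives `g(λ)` (`exists_isDegenerateGradient`).

A minimizer is obtained by the direct method. Along a minimizing sequence `λⁿ` of boundary weights
the coercivity of `e''` bounds `gⁿ = g(λⁿ)`; along an ultrafilter `λⁿ → λ` in the compact space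
`[0,∞]^N` and `gⁿ ⇀ g` weakly. Since `f` is convex, `f(g)` is at most the infimum, and everything
rests on `I_{0,λ} ⊆ J` and `g = g(λ)` (`isDegenerateGradient_of_limit`):

* where `λ i = ∞`, the weighted energies `λⁿ i ∫ |∇gⁿ|²` stay bounded, so `∇g = 0` and `g` is constant
  in the connected cell (`ae_snd_eq_zero_of_limit_top`, `IsH1On.ae_eq_const`);
* where `λ i = 0`, testing with `φ ∈ C_c^∞(cell i)` gives `∫ g φ = L φ` in the limit. So `g` is the
  `L²` representation of `L` in that cell, and it is `H¹` there, whence `i ∈ J`;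
* the test functions of `V_λ` may jump across the boundaries of the cells with `λ i = 0`, whereas
  those of `V_{λⁿ}` may not if `λⁿ i > 0`. A test function `v ∈ V_λ` is therefore replaced by an
  extension, without jumps, of its restriction to the complement of those cells
  (`exists_extension_of_mem`); the difference lives in cells of weight zero, where `g` already
  represents `L`.

The extension is the only place where the Lipschitz regularity of the unions of cells is used.
Below the graph of a Lipschitz function, an `H¹` function is approximated by smooth ones by
mollifying with kernels that look downwards (`IsH1On.exists_smooth_approx`). A smooth function is
extended by folding space along the graph: the fold is Lipschitz and covers each point at most
twice, so the extension is Lipschitz, its almost everywhere gradient is its weak gradient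
(Rademacher), and its `H¹` norm is controlled (`IsH1On.exists_extension_hypograph`). Smooth cutoffs
near the compact boundary reduce the general case to this one (`IsLipschitzOpen.exists_extension`).
-/

open Filter Topology

/-! ### Weak gradients -/

section WeakGradients

variable {d : ℕ} {U U' : Set (Eu d)} {v v' : Eu d → ℝ} {G G' : Eu d → Eu d}

theorem fderiv_apply_eq_zero_of_notMem {φ : Eu d → ℝ} (h : tsupport φ ⊆ U) {x : Eu d}
    (hx : x ∉ U) (b : Eu d) : fderiv ℝ φ x b = 0 := by
  have : x ∉ tsupport (fderiv ℝ φ) := fun h' => hx (h (tsupport_fderiv_subset ℝ h'))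
  rw [image_eq_zero_of_notMem_tsupport this]; rfl

theorem IsWeakGradOn.congr (h : IsWeakGradOn U v G) (hv : ∀ᵐ x, x ∈ U → v x = v' x)
    (hG : ∀ᵐ x, x ∈ U → G x = G' x) : IsWeakGradOn U v' G' := by
  intro φ h1 h2 h3 b
  have e1 : ∫ x, v' x * fderiv ℝ φ x b = ∫ x, v x * fderiv ℝ φ x b := by
    refine integral_congr_ae ?_
    filter_upwards [hv] with x hx
    by_cases hU : x ∈ U
    · rw [hx hU]
    · simp [fderiv_apply_eq_zero_of_notMem h3 hU]
  have e2 : ∫ x, ⟪G' x, b⟫_ℝ * φ x = ∫ x, ⟪G x, b⟫_ℝ * φ x := by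
    refine integral_congr_ae ?_
    filter_upwards [hG] with x hx
    by_cases hU : x ∈ U
    · rw [hx hU]
    · simp [image_eq_zero_of_notMem_tsupport (fun h' => hU (h3 h'))]
  rw [e1, e2, h φ h1 h2 h3 b]

theorem IsWeakGradOn.mono (h : IsWeakGradOn U v G) (hU : U' ⊆ U) : IsWeakGradOn U' v G :=
  fun φ h1 h2 h3 => h φ h1 h2 (h3.trans hU)

/-- Square integrable functions on `ℝ^d` whose restriction to `U` has the square integrable weak
gradient `G`. Nothing relates `v` and `G` outside `U`. -/
structure IsH1On (U : Set (Eu d)) (v : Eu d → ℝ) (G : Eu d → Eu d) : Prop where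
  memLp : MemLp v 2
  memLp_grad : MemLp G 2
  weakGrad : IsWeakGradOn U v G

theorem MeasureTheory.MemLp.integrable_mul_test {f g : Eu d → ℝ} (hf : MemLp f 2) (hg : Continuous g)
    (hc : HasCompactSupport g) : Integrable (fun x => f x * g x) :=
  hf.integrable_mul (q := 2) (hg.memLp_of_hasCompactSupport hc)

theorem MeasureTheory.MemLp.integrable_inner_mul_test {f : Eu d → Eu d} {g : Eu d → ℝ} (hf : MemLp f 2)
    (hg : Continuous g) (hc : HasCompactSupport g) (b : Eu d) :
    Integrable (fun x => ⟪f x, b⟫_ℝ * g x) :=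
  (hf.inner_const b).integrable_mul (q := 2) (hg.memLp_of_hasCompactSupport hc)

theorem ContDiff.continuous_fderiv_apply_const {φ : Eu d → ℝ} (h : ContDiff ℝ ∞ φ) (b : Eu d) :
    Continuous (fun x => fderiv ℝ φ x b) :=
  (h.continuous_fderiv (by simp)).clm_apply continuous_const

theorem IsH1On.add (h : IsH1On U v G) (h' : IsH1On U v' G') :
    IsH1On U (fun x => v x + v' x) (fun x => G x + G' x) := by
  refine ⟨h.memLp.add h'.memLp, h.memLp_grad.add h'.memLp_grad, fun φ h1 h2 h3 b => ?_⟩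
  have c1 := h1.continuous_fderiv_apply_const b
  have c2 : HasCompactSupport (fun x => fderiv ℝ φ x b) := h2.fderiv_apply ℝ b
  simp only [add_mul, inner_add_left]
  rw [integral_add (MemLp.integrable_mul_test h.memLp c1 c2)
      (MemLp.integrable_mul_test h'.memLp c1 c2),
    integral_add (MemLp.integrable_inner_mul_test h.memLp_grad h1.continuous h2 b)
      (MemLp.integrable_inner_mul_test h'.memLp_grad h1.continuous h2 b),
    h.weakGrad φ h1 h2 h3 b, h'.weakGrad φ h1 h2 h3 b]
  ring

theorem IsWeakGradOn.unique (hU : IsOpen U) (h : IsWeakGradOn U v G) (h' : IsWeakGradOn U v G')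
    (hG : MemLp G 2) (hG' : MemLp G' 2) : ∀ᵐ x, x ∈ U → G x = G' x := by
  have hi : LocallyIntegrable (fun x => G x - G' x) volume :=
    (hG.sub hG').locallyIntegrable (by norm_num)
  have := hU.ae_eq_zero_of_integral_contDiff_smul_eq_zero (hi.locallyIntegrableOn U) ?_
  · filter_upwards [this] with x hx hxU using sub_eq_zero.1 (hx hxU)
  intro φ h1 h2 h3
  have hint : Integrable (fun x => φ x • (G x - G' x)) :=
    hi.integrable_smul_left_of_hasCompactSupport h1.continuous h2
  refine ext_inner_right ℝ fun b => ?_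
  rw [← real_inner_comm, ← integral_inner hint b, inner_zero_left]
  have e : (fun x => ⟪b, φ x • (G x - G' x)⟫_ℝ) =
      fun x => ⟪G x, b⟫_ℝ * φ x - ⟪G' x, b⟫_ℝ * φ x := by
    funext x
    rw [inner_smul_right, inner_sub_right, real_inner_comm, real_inner_comm (G' x)]; ring
  rw [e, integral_sub (MemLp.integrable_inner_mul_test hG h1.continuous h2 b)
    (MemLp.integrable_inner_mul_test hG' h1.continuous h2 b)]
  have := h φ h1 h2 h3 b
  have := h' φ h1 h2 h3 b
  linarith

theorem norm_gradient (f : Eu d → ℝ) (x : Eu d) : ‖gradient f x‖ = ‖fderiv ℝ f x‖ := by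
  rw [gradient, LinearIsometryEquiv.norm_map]

theorem stronglyMeasurable_gradient (f : Eu d → ℝ) : StronglyMeasurable (gradient f) :=
  (((InnerProductSpace.toDual ℝ (Eu d)).symm.continuous.measurable).comp
    (measurable_fderiv ℝ f)).stronglyMeasurable

/-- By Rademacher's theorem the almost everywhere gradient of a Lipschitz function is its weak
gradient. -/
theorem LipschitzWith.isWeakGradOn {C : ℝ≥0} {f : Eu d → ℝ} (hf : LipschitzWith C f) :
    IsWeakGradOn univ f (gradient f) := by
  intro φ h1 h2 _ b
  obtain ⟨D, hD⟩ := h1.lipschitzWith_of_hasCompactSupport h2 (by simp)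
  have key := hf.integral_lineDeriv_mul_eq (μ := volume) hD h2 b
  have e1 : ∫ x, ⟪gradient f x, b⟫_ℝ * φ x = ∫ x, lineDeriv ℝ f x b * φ x := by
    refine integral_congr_ae ?_
    filter_upwards [hf.ae_differentiableAt (μ := volume)] with x hx
    rw [inner_gradient_left, hx.lineDeriv_eq_fderiv]
  have e2 : ∀ x, lineDeriv ℝ φ x (-b) * f x = -(f x * fderiv ℝ φ x b) := by
    intro x
    rw [((h1.differentiable (by simp)) x).lineDeriv_eq_fderiv, map_neg]; ring
  rw [e1, key]
  simp only [e2, integral_neg, neg_neg]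

theorem isWeakGradOn_const (c : ℝ) (U : Set (Eu d)) :
    IsWeakGradOn U (fun _ => c) (fun _ => 0) := by
  have := (LipschitzWith.const (α := Eu d) c).isWeakGradOn
  rw [gradient_fun_const'] at this
  exact this.mono (subset_univ _)

theorem IsWeakGradOn.ae_eq_zero (hU : IsOpen U) (h : IsWeakGradOn U v G) (hG : MemLp G 2) {c : ℝ}
    (hv : ∀ᵐ x, x ∈ U → v x = c) : ∀ᵐ x, x ∈ U → G x = 0 :=
  (h.congr hv (.of_forall fun _ _ => rfl)).unique hU (isWeakGradOn_const c U) hG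
    (MemLp.zero' (ε := Eu d))

theorem ContDiff.isWeakGradOn_gradient {φ : Eu d → ℝ} (h1 : ContDiff ℝ ∞ φ)
    (h2 : HasCompactSupport φ) : IsWeakGradOn univ φ (gradient φ) := by
  obtain ⟨D, hD⟩ := h1.lipschitzWith_of_hasCompactSupport h2 (by simp)
  exact hD.isWeakGradOn

theorem ContDiff.continuous_gradient {φ : Eu d → ℝ} (h : ContDiff ℝ ∞ φ) :
    Continuous (gradient φ) :=
  (InnerProductSpace.toDual ℝ (Eu d)).symm.continuous.comp (h.continuous_fderiv (by simp))

/-- The product rule. The function `χ v` is weakly differentiable wherever `χ` vanishes or `v` is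
weakly differentiable. -/
theorem IsH1On.mul_smooth (h : IsH1On U v G) {χ : Eu d → ℝ} (hχ : ContDiff ℝ ∞ χ)
    (hb : ∃ C, ∀ x, |χ x| ≤ C) (hb' : ∃ C, ∀ x, ‖gradient χ x‖ ≤ C)
    (hs : tsupport χ ∩ U' ⊆ U) :
    IsH1On U' (fun x => χ x * v x) (fun x => χ x • G x + v x • gradient χ x) := by
  obtain ⟨C, hC⟩ := hb
  obtain ⟨C', hC'⟩ := hb'
  have m1 : MemLp χ ∞ :=
    memLp_top_of_bound hχ.continuous.aestronglyMeasurable C (.of_forall fun x => by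
      simpa using hC x)
  have m2 : MemLp (gradient χ) ∞ :=
    memLp_top_of_bound (stronglyMeasurable_gradient χ).aestronglyMeasurable C' (.of_forall hC')
  have m3 : MemLp (fun x => χ x • G x) 2 := h.memLp_grad.smul m1
  have m4 : MemLp (fun x => v x • gradient χ x) 2 := m2.smul h.memLp
  refine ⟨h.memLp.mul m1, m3.add m4, fun φ h1 h2 h3 b => ?_⟩
  have hd : ∀ x, fderiv ℝ (fun y => χ y * φ y) x b
      = χ x * fderiv ℝ φ x b + φ x * fderiv ℝ χ x b := by
    intro x
    rw [fderiv_fun_mul (hχ.differentiable (by simp) x) (h1.differentiable (by simp) x)]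
    simp
  have hc : HasCompactSupport (fun y => χ y * φ y) := h2.mul_left
  have key := h.weakGrad (fun y => χ y * φ y) (hχ.mul h1) hc (by
    refine subset_trans ?_ hs
    exact subset_inter (tsupport_mul_subset_left) ((tsupport_mul_subset_right).trans h3)) b
  have c1 := h1.continuous_fderiv_apply_const b
  have c2 : HasCompactSupport (fun x => fderiv ℝ φ x b) := h2.fderiv_apply ℝ b
  simp only [hd, mul_add] at key
  rw [integral_add] at key
  · simp only [inner_add_left, add_mul, real_inner_smul_left, inner_gradient_left]
    rw [integral_add]
    · have e1 : ∀ x, χ x * v x * fderiv ℝ φ x b = v x * (χ x * fderiv ℝ φ x b) := fun x => by ring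
      have e2 : ∀ x, χ x * ⟪G x, b⟫_ℝ * φ x = ⟪G x, b⟫_ℝ * (χ x * φ x) := fun x => by ring
      have e3 : ∀ x, v x * fderiv ℝ χ x b * φ x = v x * (φ x * fderiv ℝ χ x b) := fun x => by ring
      simp only [e1, e2, e3]
      linarith
    · simpa only [real_inner_smul_left] using
        MemLp.integrable_inner_mul_test m3 h1.continuous h2 b
    · simpa only [real_inner_smul_left, inner_gradient_left] using
        MemLp.integrable_inner_mul_test m4 h1.continuous h2 b
  · exact MemLp.integrable_mul_test h.memLp (hχ.continuous.mul c1) c2.mul_left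
  · exact MemLp.integrable_mul_test h.memLp
      (h1.continuous.mul (hχ.continuous_fderiv_apply_const b)) h2.mul_right

theorem ContDiff.exists_bound {χ : Eu d → ℝ} (hχ : ContDiff ℝ ∞ χ) (hc : HasCompactSupport χ) :
    (∃ C, ∀ x, |χ x| ≤ C) ∧ ∃ C, ∀ x, ‖gradient χ x‖ ≤ C := by
  obtain ⟨C, hC⟩ := hχ.continuous.bounded_above_of_compact_support hc
  obtain ⟨C', hC'⟩ := (hχ.continuous_fderiv (by simp)).bounded_above_of_compact_support
    (hc.fderiv ℝ)
  exact ⟨⟨C, hC⟩, ⟨C', fun x => (norm_gradient χ x).trans_le (hC' x)⟩⟩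

end WeakGradients

/-! ### Folding space along a Lipschitz graph -/

section Fold

variable {d : ℕ} {a : Eu d} {ψ : Eu d → ℝ} {K : ℝ≥0}

/-- Fubini's theorem along a direction: the integral over `ℝ^d` is the integral of the integrals
along the lines parallel to `a`, each line being counted from its points in a slab of unit
width. -/
theorem lintegral_eq_lintegral_slab (ha : ‖a‖ = 1) {f : Eu d → ℝ≥0∞} (hf : Measurable f) :
    ∫⁻ x, f x = ∫⁻ x, (Ico (0 : ℝ) 1).indicator 1 ⟪a, x⟫_ℝ * ∫⁻ s : ℝ, f (x + s • a) := by
  set η : ℝ → ℝ≥0∞ := (Ico (0 : ℝ) 1).indicator 1 with hη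
  have mη : Measurable η := measurable_one.indicator measurableSet_Ico
  have iη : ∫⁻ s, η s = 1 := by
    rw [hη, lintegral_indicator_one measurableSet_Ico]; simp
  have mi : Measurable fun x : Eu d => ⟪a, x⟫_ℝ := (continuous_const.inner continuous_id).measurable
  have haa : ⟪a, a⟫_ℝ = 1 := by rw [real_inner_self_eq_norm_sq, ha]; norm_num
  calc ∫⁻ x, f x = ∫⁻ x, ∫⁻ s, η (⟪a, x⟫_ℝ - s) * f x := by
        refine lintegral_congr fun x => ?_
        rw [lintegral_mul_const _ (show Measurable fun s => η (⟪a, x⟫_ℝ - s) from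
            mη.comp (measurable_const.sub measurable_id)),
          lintegral_sub_left_eq_self η, iη, one_mul]
    _ = ∫⁻ s : ℝ, ∫⁻ x, η (⟪a, x⟫_ℝ - s) * f x := by
        refine lintegral_lintegral_swap ?_
        exact ((mη.comp ((mi.comp measurable_fst).sub measurable_snd)).mul
          (hf.comp measurable_fst)).aemeasurable
    _ = ∫⁻ s : ℝ, ∫⁻ x, η ⟪a, x⟫_ℝ * f (x + s • a) := by
        refine lintegral_congr fun s => ?_
        rw [← lintegral_add_right_eq_self (fun x => η (⟪a, x⟫_ℝ - s) * f x) (s • a)]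
        simp [inner_add_right, inner_smul_right, ha]
    _ = ∫⁻ x, ∫⁻ s : ℝ, η ⟪a, x⟫_ℝ * f (x + s • a) := by
        refine lintegral_lintegral_swap ?_
        refine ((mη.comp (mi.comp measurable_snd)).mul (hf.comp ?_)).aemeasurable
        exact (measurable_snd.add (measurable_fst.smul_const a))
    _ = _ := by
        refine lintegral_congr fun x => ?_
        rw [lintegral_const_mul]
        exact hf.comp (measurable_const.add (measurable_id.smul_const a))

/-- The signed height of `x`, measured along `a`, above the graph of `ψ` over the hyperplane
orthogonal to `a`. -/
noncomputable def graphHeight (a : Eu d) (ψ : Eu d → ℝ) (x : Eu d) : ℝ := ⟪a, x⟫_ℝ - ψ (x - ⟪a, x⟫_ℝ • a)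

/-- The points strictly below the graph of `ψ`. -/
def hypograph (a : Eu d) (ψ : Eu d → ℝ) : Set (Eu d) := {x | graphHeight a ψ x < 0}

/-- The exchange of the two sides of the graph of `ψ` along the direction `a`. -/
noncomputable def graphFlip (a : Eu d) (ψ : Eu d → ℝ) (x : Eu d) : Eu d := x - (2 * graphHeight a ψ x) • a

/-- The map that folds the points above the graph of `ψ` onto those below it. -/
noncomputable def graphFold (a : Eu d) (ψ : Eu d → ℝ) (x : Eu d) : Eu d :=
  x - (2 * max (graphHeight a ψ x) 0) • a

theorem graphHeight_add_smul (ha : ‖a‖ = 1) (x : Eu d) (s : ℝ) :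
    graphHeight a ψ (x + s • a) = graphHeight a ψ x + s := by
  have haa : ⟪a, a⟫_ℝ = 1 := by rw [real_inner_self_eq_norm_sq, ha]; norm_num
  have : x + s • a - (⟪a, x⟫_ℝ + s) • a = x - ⟪a, x⟫_ℝ • a := by
    rw [add_smul]; abel
  rw [graphHeight, graphHeight, inner_add_right, inner_smul_right, haa, mul_one, this]
  ring

theorem lipschitzWith_graphHeight (ha : ‖a‖ = 1) (hψ : LipschitzWith K ψ) :
    LipschitzWith (1 + 2 * K) (graphHeight a ψ) := by
  refine LipschitzWith.of_dist_le_mul fun x y => ?_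
  have hi : |⟪a, x⟫_ℝ - ⟪a, y⟫_ℝ| ≤ ‖x - y‖ := by
    rw [← inner_sub_right]
    simpa [ha] using abs_real_inner_le_norm a (x - y)
  have h1 : ‖(x - ⟪a, x⟫_ℝ • a) - (y - ⟪a, y⟫_ℝ • a)‖ ≤ 2 * ‖x - y‖ := by
    have : (x - ⟪a, x⟫_ℝ • a) - (y - ⟪a, y⟫_ℝ • a) = (x - y) - (⟪a, x⟫_ℝ - ⟪a, y⟫_ℝ) • a := by
      rw [sub_smul]; abel
    rw [this]
    refine (norm_sub_le _ _).trans ?_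
    rw [norm_smul, ha, mul_one, Real.norm_eq_abs]; linarith
  have h2 := hψ.dist_le_mul (x - ⟪a, x⟫_ℝ • a) (y - ⟪a, y⟫_ℝ • a)
  rw [Real.dist_eq, dist_eq_norm] at h2
  have h3 := mul_le_mul_of_nonneg_left h1 K.coe_nonneg
  rw [Real.dist_eq, dist_eq_norm, graphHeight, graphHeight]
  push_cast
  rw [abs_le] at hi h2 ⊢
  constructor <;> nlinarith

theorem isOpen_hypograph (ha : ‖a‖ = 1) (hψ : LipschitzWith K ψ) : IsOpen (hypograph a ψ) :=
  isOpen_lt (lipschitzWith_graphHeight ha hψ).continuous continuous_const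

theorem volume_graph_eq_zero (ha : ‖a‖ = 1) (hψ : LipschitzWith K ψ) :
    volume {x | graphHeight a ψ x = 0} = 0 := by
  have hc := (lipschitzWith_graphHeight ha hψ).continuous
  have hm : MeasurableSet {x | graphHeight a ψ x = 0} :=
    (isClosed_eq hc continuous_const).measurableSet
  rw [← lintegral_indicator_one hm, lintegral_eq_lintegral_slab ha (measurable_one.indicator hm)]
  have : ∀ x : Eu d, ∫⁻ s : ℝ, {x | graphHeight a ψ x = 0}.indicator (1 : Eu d → ℝ≥0∞) (x + s • a)
      = 0 := by
    intro x
    have e : (fun s : ℝ => {x | graphHeight a ψ x = 0}.indicator (1 : Eu d → ℝ≥0∞) (x + s • a))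
        = ({-graphHeight a ψ x} : Set ℝ).indicator 1 := by
      funext s
      simp only [indicator, mem_ofPred_eq, graphHeight_add_smul ha, mem_singleton_iff, Pi.one_apply]
      congr 1
      exact propext ⟨fun h => by linarith, fun h => by linarith⟩
    rw [e, lintegral_indicator_one (measurableSet_singleton _)]
    simp
  simp [this]

theorem measurePreserving_graphFlip (ha : ‖a‖ = 1) (hψ : LipschitzWith K ψ) :
    MeasurePreserving (graphFlip a ψ) volume volume := by
  have hc := (lipschitzWith_graphHeight ha hψ).continuous
  have hm : Measurable (graphFlip a ψ) :=
    (continuous_id.sub ((continuous_const.mul hc).smul continuous_const)).measurable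
  refine ⟨hm, Measure.ext fun s hs => ?_⟩
  rw [Measure.map_apply hm hs, ← lintegral_indicator_one hs, ← lintegral_indicator_one (hm hs),
    lintegral_eq_lintegral_slab ha (measurable_one.indicator hs),
    lintegral_eq_lintegral_slab ha (measurable_one.indicator (hm hs))]
  refine lintegral_congr fun x => ?_
  congr 1
  rw [← lintegral_sub_left_eq_self (fun t : ℝ => s.indicator (1 : Eu d → ℝ≥0∞) (x + t • a))
    (-(2 * graphHeight a ψ x))]
  refine lintegral_congr fun t => ?_
  have : graphFlip a ψ (x + t • a) = x + (-(2 * graphHeight a ψ x) - t) • a := by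
    rw [graphFlip, graphHeight_add_smul ha]
    module
  have hiff : x + t • a ∈ graphFlip a ψ ⁻¹' s ↔ x + (-(2 * graphHeight a ψ x) - t) • a ∈ s := by
    rw [mem_preimage, this]
  by_cases h : x + t • a ∈ graphFlip a ψ ⁻¹' s
  · rw [indicator_of_mem h, indicator_of_mem (hiff.1 h)]; rfl
  · rw [indicator_of_notMem h, indicator_of_notMem (fun h' => h (hiff.2 h'))]

theorem graphFold_of_nonpos {x : Eu d} (hx : graphHeight a ψ x ≤ 0) : graphFold a ψ x = x := by
  simp [graphFold, hx]

theorem graphFold_of_nonneg {x : Eu d} (hx : 0 ≤ graphHeight a ψ x) :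
    graphFold a ψ x = graphFlip a ψ x := by
  simp [graphFold, graphFlip, hx]

theorem graphHeight_graphFlip (ha : ‖a‖ = 1) (x : Eu d) :
    graphHeight a ψ (graphFlip a ψ x) = - graphHeight a ψ x := by
  rw [graphFlip, sub_eq_add_neg, ← neg_smul, graphHeight_add_smul ha]; ring

theorem lipschitzWith_graphFold (ha : ‖a‖ = 1) (hψ : LipschitzWith K ψ) :
    LipschitzWith (1 + 2 * (1 + 2 * K)) (graphFold a ψ) := by
  refine LipschitzWith.of_dist_le_mul fun x y => ?_
  have h := (lipschitzWith_graphHeight ha hψ).dist_le_mul x y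
  have h' : |max (graphHeight a ψ x) 0 - max (graphHeight a ψ y) 0| ≤
      |graphHeight a ψ x - graphHeight a ψ y| := abs_max_sub_max_le_abs _ _ _
  have : graphFold a ψ x - graphFold a ψ y = (x - y) -
      (2 * (max (graphHeight a ψ x) 0 - max (graphHeight a ψ y) 0)) • a := by
    rw [graphFold, graphFold]; module
  rw [dist_eq_norm, this, dist_eq_norm]
  rw [Real.dist_eq, dist_eq_norm] at h
  refine (norm_sub_le _ _).trans ?_
  rw [norm_smul, ha, mul_one, Real.norm_eq_abs, abs_mul, abs_two]
  push_cast at h ⊢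
  nlinarith

/-- Each point below the graph is covered at most twice by the fold. -/
theorem map_graphFold_le (ha : ‖a‖ = 1) (hψ : LipschitzWith K ψ) :
    (volume : Measure (Eu d)).map (graphFold a ψ) ≤
      (2 : ℝ≥0∞) • volume.restrict (hypograph a ψ) := by
  have hm := (lipschitzWith_graphFold ha hψ).continuous.measurable
  have mD : MeasurableSet (hypograph a ψ) := (isOpen_hypograph ha hψ).measurableSet
  have hz := volume_graph_eq_zero ha hψ
  refine Measure.le_iff.2 fun s hs => ?_
  rw [Measure.map_apply hm hs, Measure.smul_apply, Measure.restrict_apply hs, smul_eq_mul, two_mul]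
  have hsub : graphFold a ψ ⁻¹' s ⊆ ((s ∩ hypograph a ψ) ∪
      graphFlip a ψ ⁻¹' (s ∩ hypograph a ψ)) ∪ {x | graphHeight a ψ x = 0} := by
    intro x hx
    rcases lt_trichotomy (graphHeight a ψ x) 0 with h | h | h
    · rw [mem_preimage, graphFold_of_nonpos h.le] at hx
      exact .inl (.inl ⟨hx, h⟩)
    · exact .inr h
    · rw [mem_preimage, graphFold_of_nonneg h.le] at hx
      refine .inl (.inr ⟨hx, ?_⟩)
      rw [hypograph, mem_ofPred_eq, graphHeight_graphFlip ha]; linarith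
  refine (measure_mono hsub).trans ((measure_union_le _ _).trans ?_)
  rw [hz, add_zero]
  refine (measure_union_le _ _).trans ?_
  rw [(measurePreserving_graphFlip ha hψ).measure_preimage (hs.inter mD).nullMeasurableSet]

theorem eLpNorm_comp_graphFold_le (ha : ‖a‖ = 1) (hψ : LipschitzWith K ψ)
    {F : Type*} [NormedAddCommGroup F] {f : Eu d → F} (hf : StronglyMeasurable f) :
    eLpNorm (fun x => f (graphFold a ψ x)) 2 volume ≤
      (2 : ℝ≥0∞) * eLpNorm f 2 (volume.restrict (hypograph a ψ)) := by
  have hm := (lipschitzWith_graphFold ha hψ).continuous.measurable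
  have e : eLpNorm (fun x => f (graphFold a ψ x)) 2 volume =
      eLpNorm f 2 ((volume : Measure (Eu d)).map (graphFold a ψ)) :=
    (eLpNorm_map_measure hf.aestronglyMeasurable hm.aemeasurable).symm
  rw [e]
  refine (eLpNorm_mono_measure f (map_graphFold_le ha hψ)).trans ?_
  rw [eLpNorm_smul_measure_of_ne_top (by simp), smul_eq_mul]
  gcongr
  calc (2 : ℝ≥0∞) ^ (1 / (2 : ℝ≥0∞)).toReal ≤ 2 ^ (1 : ℝ) :=
        ENNReal.rpow_le_rpow_of_exponent_le (by norm_num) (by norm_num)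
    _ = 2 := ENNReal.rpow_one 2

/-- The boundary of a Lipschitz open set is a null set, being locally contained in graphs. -/
theorem IsLipschitzOpen.volume_frontier {U : Set (Eu d)} (hU : IsLipschitzOpen U) :
    volume (frontier U) = 0 := by
  refine measure_null_of_locally_null _ fun p hp => ?_
  obtain ⟨r, hr, a, ha, K, ψ, hψ, h⟩ := hU.2 p hp
  refine ⟨frontier U ∩ Metric.ball p r,
    inter_mem_nhdsWithin _ (Metric.ball_mem_nhds p hr), ?_⟩
  refine measure_mono_null ?_ (volume_graph_eq_zero ha hψ)
  rintro x ⟨hx, hxr⟩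
  have hc := (lipschitzWith_graphHeight ha hψ).continuous
  have hiff : ∀ y ∈ Metric.ball p r, (y ∈ U ↔ 0 < graphHeight a ψ y) := fun y hy => by
    rw [h y hy, graphHeight, sub_pos]
  rw [hU.1.frontier_eq] at hx
  refine le_antisymm (not_lt.1 fun h' => hx.2 ((hiff x hxr).2 h')) (not_lt.1 fun h' => ?_)
  have : ∀ᶠ y in 𝓝 x, y ∉ U := by
    filter_upwards [Metric.isOpen_ball.mem_nhds hxr,
      (isOpen_lt hc continuous_const).mem_nhds h'] with y hy hy'
    rw [hiff y hy]
    exact not_lt.2 (le_of_lt hy')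
  obtain ⟨y, hy, hyU⟩ := ((mem_closure_iff_frequently.1 hx.1).and_eventually this).exists
  exact hyU hy

end Fold

/-! ### Mollification -/

/-- Translations act continuously on `L²`. -/
theorem eLpNorm_translate_sub_le {d : ℕ} {V : Type*} [NormedAddCommGroup V] {f : Eu d → V} (hf : MemLp f 2) {ε : ℝ≥0∞} (hε : 0 < ε) :
    ∃ ρ : ℝ, 0 < ρ ∧ ∀ t : Eu d, ‖t‖ ≤ ρ → eLpNorm (fun x => f (x - t) - f x) 2 ≤ ε := by
  have : Fact ((2 : ℝ≥0∞) ≠ ⊤) := ⟨ENNReal.ofNat_ne_top⟩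
  set F := hf.toLp f with hF
  have hc : Continuous fun t : Eu d => DomAddAct.mk (-t) +ᵥ F := by
    have : Continuous fun t : Eu d => (DomAddAct.mk (-t) : (Eu d)ᵈᵃᵃ) :=
      DomAddAct.continuous_mk.comp continuous_neg
    exact this.vadd continuous_const
  have h0 : DomAddAct.mk (-(0 : Eu d)) +ᵥ F = F := by simp
  have ht := hc.tendsto 0
  rw [h0] at ht
  have hev := (EMetric.tendsto_nhds.1 ht) ε hε
  obtain ⟨r, hr, hball⟩ := Metric.eventually_nhds_iff.1 hev
  refine ⟨r / 2, by positivity, fun t htr => ?_⟩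
  have := (hball (y := t) (by rw [dist_zero_right]; linarith)).le
  rw [Lp.edist_def] at this
  refine le_trans (le_of_eq (eLpNorm_congr_ae ?_)) this
  have e1 := DomAddAct.vadd_Lp_ae_eq (DomAddAct.mk (-t)) F
  have e2 : F =ᵐ[volume] f := hf.coeFn_toLp
  have e3 := (measurePreserving_add_left (volume : Measure (Eu d)) (-t)).quasiMeasurePreserving.ae_eq_comp e2
  filter_upwards [e1, e2, e3] with x h1 h2 h3
  rw [Pi.sub_apply, h1, h2]
  have h3' : F (-t + x) = f (-t + x) := h3
  simp only [Equiv.symm_apply_apply, vadd_eq_add, h3']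
  rw [neg_add_eq_sub]

section Mollify

variable {d : ℕ} {V : Type*} [NormedAddCommGroup V] [NormedSpace ℝ V]

/-- A mollifying kernel: a nonnegative test function of integral one, supported in the ball of
radius `ρ` around the origin (but possibly off the origin). -/
structure IsMollifier (η : Eu d → ℝ) (ρ : ℝ) : Prop where
  contDiff : ContDiff ℝ ∞ η
  hasCompactSupport : HasCompactSupport η
  nonneg : ∀ t, 0 ≤ η t
  integral_eq_one : ∫ t, η t = 1
  norm_le : ∀ t, η t ≠ 0 → ‖t‖ ≤ ρ

/-- The mollification of `f` by the kernel `η`. -/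
noncomputable def mollify (η : Eu d → ℝ) (f : Eu d → V) (x : Eu d) : V := ∫ t, η t • f (x - t)

theorem mollify_eq_convolution (η : Eu d → ℝ) (f : Eu d → V) :
    mollify η f = convolution η f (ContinuousLinearMap.lsmul ℝ ℝ) volume := rfl

/-- Averages of translates: mollification with a small kernel is close to the identity in `L²`. -/
theorem eLpNorm_mollify_sub_le [CompleteSpace V] {f : Eu d → V} (hf : MemLp f 2) {ε : ℝ≥0∞}
    (hε : 0 < ε) :
    ∃ ρ : ℝ, 0 < ρ ∧ ∀ η : Eu d → ℝ, IsMollifier η ρ →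
      eLpNorm (fun x => mollify η f x - f x) 2 ≤ ε := by
  obtain ⟨ρ, hρ, h⟩ := eLpNorm_translate_sub_le hf hε
  refine ⟨ρ, hρ, fun η hη => ?_⟩
  have hint : Integrable η := hη.contDiff.continuous.integrable_of_hasCompactSupport
    hη.hasCompactSupport
  -- The mollification is an average of translates over the probability measure `η dt`, so that its
  -- square is at most the average of the squares.
  set ν : Measure (Eu d) := volume.withDensity fun t => ENNReal.ofReal (η t) with hν
  have mη : Measurable fun t => ENNReal.ofReal (η t) :=
    hη.contDiff.continuous.measurable.ennreal_ofReal
  have : IsProbabilityMeasure ν := ⟨by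
    rw [hν, withDensity_apply _ MeasurableSet.univ, Measure.restrict_univ,
      ← ofReal_integral_eq_lintegral_ofReal hint (.of_forall hη.nonneg), hη.integral_eq_one,
      ENNReal.ofReal_one]⟩
  have hac : ν ≪ volume := withDensity_absolutelyContinuous _ _
  have hfm := hf.aestronglyMeasurable
  have hpair : AEStronglyMeasurable (fun z : Eu d × Eu d => f (z.1 - z.2) - f z.1)
      (volume.prod ν) := by
    have q1 : AEStronglyMeasurable (fun z : Eu d × Eu d => f (z.1 - z.2))
        ((volume : Measure (Eu d)).prod volume) :=
      hfm.comp_quasiMeasurePreserving (quasiMeasurePreserving_sub volume volume)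
    exact (q1.mono_ac (Measure.AbsolutelyContinuous.rfl.prod hac)).sub
      (hfm.comp_quasiMeasurePreserving Measure.quasiMeasurePreserving_fst)
  have hpt : ∀ x, ‖mollify η f x - f x‖ₑ ≤ ∫⁻ t, ‖f (x - t) - f x‖ₑ ∂ν := by
    intro x
    have hex : Integrable fun t => η t • f (x - t) :=
      (hη.hasCompactSupport.convolutionExists_left (ContinuousLinearMap.lsmul ℝ ℝ)
        hη.contDiff.continuous (hf.locallyIntegrable (by norm_num))) x
    have e : mollify η f x - f x = ∫ t, η t • (f (x - t) - f x) := by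
      simp only [smul_sub]
      rw [integral_sub hex (hint.smul_const _), integral_smul_const, hη.integral_eq_one, one_smul]
      rfl
    rw [e]
    refine (enorm_integral_le_lintegral_enorm _).trans (le_of_eq ?_)
    rw [hν, lintegral_withDensity_eq_lintegral_mul_non_measurable₀ _ mη.aemeasurable
      (.of_forall fun _ => ENNReal.ofReal_lt_top)]
    refine lintegral_congr fun t => ?_
    rw [enorm_smul, Real.enorm_of_nonneg (hη.nonneg t)]; rfl
  have hsq : ∀ x, AEStronglyMeasurable (fun t => f (x - t) - f x) ν →
      ‖mollify η f x - f x‖ₑ ^ (2 : ℝ) ≤ ∫⁻ t, ‖f (x - t) - f x‖ₑ ^ (2 : ℝ) ∂ν := by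
    intro x hx
    have h1 := eLpNorm_le_eLpNorm_of_exponent_le (μ := ν) (p := 1) (q := 2) (by norm_num) hx
    rw [eLpNorm_one_eq_lintegral_enorm] at h1
    have h2 := ENNReal.rpow_le_rpow ((hpt x).trans h1) (by norm_num : (0 : ℝ) ≤ 2)
    have h3 := eLpNorm_nnreal_pow_eq_lintegral (f := fun t => f (x - t) - f x) (μ := ν) (p := 2)
      (by norm_num)
    refine h2.trans (le_of_eq ?_)
    simpa using h3
  have h2 : eLpNorm (fun x => mollify η f x - f x) 2 ^ (2 : ℝ) ≤ ε ^ (2 : ℝ) := by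
    have h3 := eLpNorm_nnreal_pow_eq_lintegral (f := fun x => mollify η f x - f x)
      (μ := volume) (p := 2) (by norm_num)
    have h3' : eLpNorm (fun x => mollify η f x - f x) 2 ^ (2 : ℝ) =
      ∫⁻ x, ‖mollify η f x - f x‖ₑ ^ (2 : ℝ) := by simpa using h3
    rw [h3']
    calc ∫⁻ x, ‖mollify η f x - f x‖ₑ ^ (2 : ℝ)
        ≤ ∫⁻ x, ∫⁻ t, ‖f (x - t) - f x‖ₑ ^ (2 : ℝ) ∂ν := by
          refine lintegral_mono_ae ?_
          filter_upwards [hpair.prodMk_left] with x hx using hsq x hx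
      _ = ∫⁻ t, ∫⁻ x, ‖f (x - t) - f x‖ₑ ^ (2 : ℝ) ∂volume ∂ν :=
          lintegral_lintegral_swap (hpair.enorm.pow_const _)
      _ ≤ ∫⁻ t, ε ^ (2 : ℝ) ∂ν := by
          refine lintegral_mono_ae ?_
          have hsupp : ∀ᵐ t ∂ν, ENNReal.ofReal (η t) ≠ 0 := by
            rw [hν, ae_withDensity_iff mη]
            exact .of_forall fun t ht => ht
          filter_upwards [hsupp] with t ht
          have h4 := eLpNorm_nnreal_pow_eq_lintegral (f := fun x => f (x - t) - f x)
            (μ := volume) (p := 2) (by norm_num)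
          have h4' : eLpNorm (fun x => f (x - t) - f x) 2 ^ (2 : ℝ) =
            ∫⁻ x, ‖f (x - t) - f x‖ₑ ^ (2 : ℝ) := by simpa using h4
          rw [← h4']
          refine ENNReal.rpow_le_rpow (h t (hη.norm_le t fun h0 => ht ?_)) (by norm_num)
          rw [h0, ENNReal.ofReal_zero]
      _ = ε ^ (2 : ℝ) := by simp
  exact (ENNReal.rpow_le_rpow_iff (by norm_num)).1 h2

theorem IsMollifier.contDiff_mollify {η : Eu d → ℝ} {ρ : ℝ} (hη : IsMollifier η ρ) {f : Eu d → ℝ}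
    (hf : MemLp f 2) : ContDiff ℝ ∞ (mollify η f) :=
  hη.hasCompactSupport.contDiff_convolution_left (ContinuousLinearMap.lsmul ℝ ℝ) hη.contDiff
    (hf.locallyIntegrable (by norm_num))

theorem IsMollifier.hasCompactSupport_mollify {η : Eu d → ℝ} {ρ : ℝ} (hη : IsMollifier η ρ)
    {f : Eu d → ℝ} (hf : HasCompactSupport f) : HasCompactSupport (mollify η f) :=
  HasCompactSupport.convolution (L := ContinuousLinearMap.lsmul ℝ ℝ) hη.hasCompactSupport hf

/-- Mollification commutes with the weak gradient at points from which the kernel does not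
reach out of the domain. -/
theorem gradient_mollify {η : Eu d → ℝ} {ρ : ℝ} (hη : IsMollifier η ρ) {D : Set (Eu d)}
    {v : Eu d → ℝ} {G : Eu d → Eu d} (h : IsH1On D v G) {x : Eu d}
    (hx : ∀ t ∈ tsupport η, x - t ∈ D) : gradient (mollify η v) x = mollify η G x := by
  have hv := h.memLp.locallyIntegrable (by norm_num)
  have hG := h.memLp_grad.locallyIntegrable (by norm_num)
  have h1 : ContDiff ℝ 1 η := hη.contDiff.of_le (by simp)
  have hd := hη.hasCompactSupport.hasFDerivAt_convolution_left (ContinuousLinearMap.lsmul ℝ ℝ) h1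
    hv x
  have hφc : ContDiff ℝ ∞ fun y => η (x - y) := hη.contDiff.comp (contDiff_const.sub contDiff_id)
  have hφs : HasCompactSupport fun y => η (x - y) :=
    hη.hasCompactSupport.comp_homeomorph (Homeomorph.subLeft x)
  have hφt : tsupport (fun y => η (x - y)) ⊆ D := by
    intro y hy
    have : x - y ∈ tsupport η := by
      have := tsupport_comp_eq_preimage η (Homeomorph.subLeft x)
      have hy' : y ∈ tsupport (η ∘ (Homeomorph.subLeft x)) := hy
      rw [this] at hy'
      exact hy'
    simpa using hx _ this
  refine ext_inner_right ℝ fun b => ?_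
  have key := h.weakGrad _ hφc hφs hφt b
  have hfd : ∀ y, fderiv ℝ (fun y => η (x - y)) y b = - fderiv ℝ η (x - y) b := by
    intro y
    have h2 : HasFDerivAt (fun y => η (x - y)) ((fderiv ℝ η (x - y)).comp
        (-(ContinuousLinearMap.id ℝ (Eu d)))) y :=
      ((hη.contDiff.differentiable (by simp)) (x - y)).hasFDerivAt.comp y
        ((hasFDerivAt_id y).const_sub x)
    rw [h2.fderiv]; simp
  simp only [hfd, mul_neg, integral_neg, neg_inj] at key
  have hexG : Integrable fun t => η t • G (x - t) :=
    (hη.hasCompactSupport.convolutionExists_left (ContinuousLinearMap.lsmul ℝ ℝ)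
      hη.contDiff.continuous hG) x
  have hexv := (hη.hasCompactSupport.fderiv ℝ).convolutionExists_left
    ((ContinuousLinearMap.lsmul ℝ ℝ).precompL (Eu d)) (h1.continuous_fderiv (by simp)) hv x
  rw [inner_gradient_left, mollify_eq_convolution, hd.fderiv, mollify, real_inner_comm,
    ← integral_inner hexG b, convolution_def, ContinuousLinearMap.integral_apply hexv,
    ← integral_sub_left_eq_self _ volume x, ← integral_sub_left_eq_self (fun t =>
      ⟪b, η t • G (x - t)⟫_ℝ) volume x]
  have e1 : ∀ y, (((ContinuousLinearMap.lsmul ℝ ℝ).precompL (Eu d)) (fderiv ℝ η (x - y))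
      (v (x - (x - y)))) b = v y * fderiv ℝ η (x - y) b := by
    intro y
    simp [ContinuousLinearMap.precompL_apply, mul_comm]
  have e2 : ∀ y, ⟪b, η (x - y) • G (x - (x - y))⟫_ℝ = ⟪G y, b⟫_ℝ * η (x - y) := by
    intro y
    rw [inner_smul_right, sub_sub_cancel, real_inner_comm, mul_comm]
  simp only [e1, e2]
  exact key

theorem ContDiffBump.isMollifier_normed {c : Eu d} (β : ContDiffBump c) :
    IsMollifier (β.normed volume) (‖c‖ + β.rOut) where
  contDiff := β.contDiff_normed
  hasCompactSupport := β.hasCompactSupport_normed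
  nonneg := β.nonneg_normed
  integral_eq_one := β.integral_normed
  norm_le t ht := by
    have : t ∈ Function.support (β.normed volume) := ht
    rw [β.support_normed_eq, mem_ball_iff_norm] at this
    have := norm_add_le c (t - c)
    rw [add_sub_cancel] at this
    linarith

/-- A function whose weak gradient vanishes is locally constant. -/
theorem IsH1On.ae_eq_const_ball {U : Set (Eu d)} {v : Eu d → ℝ} (h : IsH1On U v 0) {x₀ : Eu d}
    {r : ℝ} (hr : 0 < r) (hU : Metric.ball x₀ (2 * r) ⊆ U) :
    ∃ C, ∀ᵐ x, x ∈ Metric.ball x₀ r → v x = C := by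
  let β : ℕ → ContDiffBump (0 : Eu d) := fun n =>
    ⟨r / (n + 3) / 2, r / (n + 3), by positivity, half_lt_self (by positivity)⟩
  have hlim : Tendsto (fun n => (β n).rOut) atTop (𝓝 0) := by
    have : Tendsto (fun n : ℕ => r / ((n : ℝ) + 3)) atTop (𝓝 0) :=
      tendsto_const_nhds.div_atTop
        (tendsto_atTop_add_const_right _ _ tendsto_natCast_atTop_atTop)
    exact this
  have hrat : ∀ᶠ n in atTop, (β n).rOut ≤ 2 * (β n).rIn := by
    refine .of_forall fun n => ?_
    change r / (n + 3) ≤ 2 * (r / (n + 3) / 2)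
    linarith
  have hae := ContDiffBump.ae_convolution_tendsto_right_of_locallyIntegrable (μ := volume) hlim hrat
    (h.memLp.locallyIntegrable (by norm_num))
  have hconst : ∀ n, ∀ x ∈ Metric.ball x₀ r, ∀ y ∈ Metric.ball x₀ r,
      mollify ((β n).normed volume) v x = mollify ((β n).normed volume) v y := by
    intro n x hx y hy
    have hη := (β n).isMollifier_normed
    refine Metric.isOpen_ball.is_const_of_fderiv_eq_zero (𝕜 := ℝ) (convex_ball x₀ r).isPreconnected
      ((hη.contDiff_mollify h.memLp).differentiable (by simp)).differentiableOn ?_ hx hy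
    intro z hz
    have hg : gradient (mollify ((β n).normed volume) v) z = 0 := by
      rw [gradient_mollify hη h]
      · simp [mollify]
      · intro t ht
        rw [(β n).tsupport_normed_eq, mem_closedBall_zero_iff] at ht
        refine hU ?_
        rw [mem_ball_iff_norm] at hz ⊢
        have h1 : (β n).rOut ≤ r := by
          change r / (n + 3) ≤ r
          exact div_le_self hr.le (by linarith [(n.cast_nonneg : (0 : ℝ) ≤ n)])
        calc ‖z - t - x₀‖ = ‖(z - x₀) - t‖ := by congr 1; abel
          _ ≤ ‖z - x₀‖ + ‖t‖ := norm_sub_le _ _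
          _ < 2 * r := by linarith
    have := norm_gradient (mollify ((β n).normed volume) v) z
    rw [hg, norm_zero] at this
    exact norm_eq_zero.1 this.symm
  obtain ⟨y, hy, hyl⟩ : ∃ y ∈ Metric.ball x₀ r, Tendsto (fun n =>
      mollify ((β n).normed volume) v y) atTop (𝓝 (v y)) := by
    by_contra! hcon
    have : volume (Metric.ball x₀ r) = 0 :=
      measure_mono_null (fun y hy => hcon y hy) (ae_iff.1 hae)
    exact (Metric.measure_ball_pos volume x₀ hr).ne' this
  refine ⟨v y, ?_⟩
  filter_upwards [hae] with x hx hxr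
  refine tendsto_nhds_unique hx (hyl.congr fun n => ?_)
  exact hconst n y hy x hxr

/-- A function whose weak gradient vanishes is constant on connected open sets. -/
theorem IsH1On.ae_eq_const {U : Set (Eu d)} (hU : IsOpen U) (hc : IsConnected U) {v : Eu d → ℝ}
    (h : IsH1On U v 0) : ∃ C, ∀ᵐ x, x ∈ U → v x = C := by
  have hloc : ∀ x ∈ U, ∃ C, ∀ᶠ r in 𝓝[>] (0 : ℝ), ∀ᵐ y, y ∈ Metric.ball x r → v y = C := by
    intro x hx
    obtain ⟨r, hr, hball⟩ := Metric.isOpen_iff.1 hU x hx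
    obtain ⟨C, hC⟩ := h.ae_eq_const_ball (x₀ := x) (half_pos hr) (by
      rwa [mul_div_cancel₀ _ (two_ne_zero)])
    refine ⟨C, ?_⟩
    filter_upwards [Ioo_mem_nhdsGT (half_pos hr)] with s hs
    filter_upwards [hC] with y hy hys
    exact hy (Metric.ball_subset_ball hs.2.le hys)
  obtain ⟨x₀, hx₀⟩ := hc.nonempty
  obtain ⟨C, hC⟩ := hloc x₀ hx₀
  refine ⟨C, ?_⟩
  let A : Set (Eu d) := ⋃₀ {O | IsOpen O ∧ ∀ᵐ y, y ∈ O → v y = C}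
  let B : Set (Eu d) := ⋃₀ {O | IsOpen O ∧ ∃ C', C' ≠ C ∧ ∀ᵐ y, y ∈ O → v y = C'}
  have hA : IsOpen A := isOpen_sUnion fun O hO => hO.1
  have hB : IsOpen B := isOpen_sUnion fun O hO => hO.1
  have hcover : U ⊆ A ∪ B := by
    intro x hx
    obtain ⟨C', hC'⟩ := hloc x hx
    obtain ⟨r, hr, hr0⟩ := (hC'.and self_mem_nhdsWithin).exists
    by_cases hCC : C' = C
    · exact .inl ⟨_, ⟨Metric.isOpen_ball, hCC ▸ hr⟩, Metric.mem_ball_self hr0⟩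
    · exact .inr ⟨_, ⟨Metric.isOpen_ball, C', hCC, hr⟩, Metric.mem_ball_self hr0⟩
  have hUA : (U ∩ A).Nonempty := by
    obtain ⟨r, hr, hr0⟩ := (hC.and self_mem_nhdsWithin).exists
    exact ⟨x₀, hx₀, _, ⟨Metric.isOpen_ball, hr⟩, Metric.mem_ball_self hr0⟩
  have hUB : ¬ (U ∩ B).Nonempty := by
    intro hne
    obtain ⟨x, -, ⟨O, ⟨hO, hOC⟩, hxO⟩, O', ⟨hO', C', hne', hOC'⟩, hxO'⟩ :=
      hc.isPreconnected A B hA hB hcover hUA hne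
    have hpos := (hO.inter hO').measure_pos volume ⟨x, hxO, hxO'⟩
    refine hpos.ne' (measure_mono_null ?_ (ae_iff.1 (hOC.and hOC')))
    rintro y ⟨hy, hy'⟩ ⟨h1, h2⟩
    exact hne' ((h2 hy').symm.trans (h1 hy))
  have : volume (U ∩ {x | v x ≠ C}) = 0 := by
    refine measure_null_of_locally_null _ fun x hx => ?_
    obtain ⟨O, ⟨hO, hOC⟩, hxO⟩ : x ∈ A := (hcover hx.1).resolve_right fun hxB => hUB ⟨x, hx.1, hxB⟩
    refine ⟨(U ∩ {x | v x ≠ C}) ∩ O, inter_mem_nhdsWithin _ (hO.mem_nhds hxO),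
      measure_mono_null ?_ (ae_iff.1 hOC)⟩
    rintro y ⟨hy, hyO⟩ h'
    exact hy.2 (h' hyO)
  rw [ae_iff]
  refine measure_mono_null (fun y hy => ?_) this
  have hy' : ¬ (y ∈ U → v y = C) := hy
  push Not at hy'
  exact hy'

end Mollify

/-! ### Extension of Sobolev functions across Lipschitz boundaries -/

section Extension

variable {d : ℕ}

/-- The integral of `p.1 ∂_b φ + ⟪p.2, b⟫ φ`, as a continuous functional of `p`. -/
theorem exists_clm_weakGrad {φ : Eu d → ℝ} (h1 : ContDiff ℝ ∞ φ) (h2 : HasCompactSupport φ)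
    (b : Eu d) : ∃ T : FunGrad d →L[ℝ] ℝ, ∀ p : FunGrad d,
      T p = (∫ x, p.fst x * fderiv ℝ φ x b) + ∫ x, ⟪p.snd x, b⟫_ℝ * φ x := by
  have m1 : MemLp (fun x => fderiv ℝ φ x b) 2 (volume : Measure (Eu d)) :=
    (h1.continuous_fderiv_apply_const b).memLp_of_hasCompactSupport (h2.fderiv_apply ℝ b)
  have m2 : MemLp (fun x => φ x • b) 2 (volume : Measure (Eu d)) :=
    (h1.continuous.smul continuous_const).memLp_of_hasCompactSupport h2.smul_right
  refine ⟨innerSL ℝ (WithLp.toLp 2 (m1.toLp _, m2.toLp _) : FunGrad d), fun p => ?_⟩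
  rw [innerSL_apply_apply, WithLp.prod_inner_apply, L2.inner_def, L2.inner_def]
  congr 1
  · refine integral_congr_ae ?_
    filter_upwards [m1.coeFn_toLp] with x hx
    simp [hx]
  · refine integral_congr_ae ?_
    filter_upwards [m2.coeFn_toLp] with x hx
    simp only [hx, real_inner_smul_left]
    rw [real_inner_comm, mul_comm]
    rfl

theorem isClosed_isWeakGradOn (U : Set (Eu d)) :
    IsClosed {p : FunGrad d | IsWeakGradOn U p.fst p.snd} := by
  have : {p : FunGrad d | IsWeakGradOn U p.fst p.snd} =
      ⋂ (φ : Eu d → ℝ) (_ : ContDiff ℝ ∞ φ) (_ : HasCompactSupport φ) (_ : tsupport φ ⊆ U)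
        (b : Eu d), {p : FunGrad d |
          (∫ x, p.fst x * fderiv ℝ φ x b) + ∫ x, ⟪p.snd x, b⟫_ℝ * φ x = 0} := by
    ext p
    simp only [mem_iInter, mem_ofPred_eq, IsWeakGradOn, eq_neg_iff_add_eq_zero]
  rw [this]
  refine isClosed_iInter fun φ => isClosed_iInter fun h1 => isClosed_iInter fun h2 =>
    isClosed_iInter fun _ => isClosed_iInter fun b => ?_
  obtain ⟨T, hT⟩ := exists_clm_weakGrad h1 h2 b
  simp only [← hT]
  exact isClosed_eq T.continuous continuous_const

theorem FunGrad.isH1On {U : Set (Eu d)} {p : FunGrad d} (h : IsWeakGradOn U p.fst p.snd) :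
    IsH1On U p.fst p.snd := ⟨Lp.memLp _, Lp.memLp _, h⟩

/-- The pointwise chain rule inequality for a Lipschitz change of variables. -/
theorem norm_gradient_comp_le {f : Eu d → ℝ} (hf : Differentiable ℝ f) {C : ℝ≥0} {R : Eu d → Eu d}
    (hR : LipschitzWith C R) (x : Eu d) :
    ‖gradient (fun y => f (R y)) x‖ ≤ C * ‖gradient f (R x)‖ := by
  by_cases hd : DifferentiableAt ℝ (fun y => f (R y)) x
  swap
  · rw [gradient_eq_zero_of_not_differentiableAt hd, norm_zero]; positivity
  rw [norm_gradient, norm_gradient]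
  have key : ∀ ε : ℝ, 0 < ε → ‖fderiv ℝ (fun y => f (R y)) x‖ ≤
      (‖fderiv ℝ f (R x)‖ + ε) * C := by
    intro ε hε
    refine hd.hasFDerivAt.le_of_lip' (by positivity) ?_
    have h1 := (hasFDerivAt_iff_isLittleO.1 (hf (R x)).hasFDerivAt).def hε
    filter_upwards [hR.continuous.continuousAt.eventually h1] with y hy
    have h2 := hR.dist_le_mul y x
    rw [dist_eq_norm, dist_eq_norm] at h2
    have h3 : ‖f (R y) - f (R x)‖ ≤ (‖fderiv ℝ f (R x)‖ + ε) * ‖R y - R x‖ := by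
      have h4 := norm_add_le (f (R y) - f (R x) - fderiv ℝ f (R x) (R y - R x))
        (fderiv ℝ f (R x) (R y - R x))
      rw [sub_add_cancel] at h4
      have h5 := (fderiv ℝ f (R x)).le_opNorm (R y - R x)
      linarith
    refine h3.trans ?_
    rw [mul_assoc]
    exact mul_le_mul_of_nonneg_left h2 (by positivity)
  have hlim : Tendsto (fun ε : ℝ => (‖fderiv ℝ f (R x)‖ + ε) * C) (𝓝[>] 0)
      (𝓝 ((‖fderiv ℝ f (R x)‖ + 0) * C)) := by
    refine Tendsto.mono_left ?_ nhdsWithin_le_nhds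
    exact (continuous_const.add continuous_id).mul continuous_const |>.tendsto 0
  have := ge_of_tendsto hlim (by filter_upwards [self_mem_nhdsWithin] with ε hε using key ε hε)
  rw [add_zero] at this
  rwa [mul_comm]

theorem IsMollifier.mono {η : Eu d → ℝ} {ρ ρ' : ℝ} (h : IsMollifier η ρ) (hρ : ρ ≤ ρ') :
    IsMollifier η ρ' :=
  ⟨h.1, h.2, h.3, h.4, fun t ht => (h.5 t ht).trans hρ⟩

variable {a : Eu d} {ψ : Eu d → ℝ} {K : ℝ≥0}

/-- Density of smooth functions up to the boundary: mollification with kernels that look into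
the hypograph. -/
theorem IsH1On.exists_smooth_approx (ha : ‖a‖ = 1) (hψ : LipschitzWith K ψ) {v : Eu d → ℝ}
    {G : Eu d → Eu d} (h : IsH1On (hypograph a ψ) v G) (hc : HasCompactSupport v) {ε : ℝ≥0∞}
    (hε : 0 < ε) :
    ∃ φ : Eu d → ℝ, ContDiff ℝ ∞ φ ∧ HasCompactSupport φ ∧
      eLpNorm (fun x => φ x - v x) 2 (volume.restrict (hypograph a ψ)) ≤ ε ∧
      eLpNorm (fun x => gradient φ x - G x) 2 (volume.restrict (hypograph a ψ)) ≤ ε := by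
  obtain ⟨ρ₁, hρ₁, H₁⟩ := eLpNorm_mollify_sub_le h.memLp hε
  obtain ⟨ρ₂, hρ₂, H₂⟩ := eLpNorm_mollify_sub_le h.memLp_grad hε
  set ρ := min ρ₁ ρ₂
  have hρ : 0 < ρ := lt_min hρ₁ hρ₂
  set L : ℝ := 1 + 2 * K with hL
  have hL1 : 1 ≤ L := by rw [hL]; linarith [K.coe_nonneg]
  -- The kernel sits near `(ρ / 2) a`, in a ball so small that `x - t` lies below the graph
  -- whenever `x` does and `t` belongs to the support of the kernel.
  let β : ContDiffBump ((ρ / 2) • a) :=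
    ⟨ρ / (2 * L) / 2, ρ / (2 * L), by positivity, half_lt_self (by positivity)⟩
  have hle : ‖(ρ / 2) • a‖ + β.rOut ≤ ρ := by
    rw [norm_smul, ha, mul_one, Real.norm_of_nonneg (by positivity)]
    have : ρ / (2 * L) ≤ ρ / 2 := by
      apply div_le_div_of_nonneg_left hρ.le (by norm_num) (by linarith)
    change ρ / 2 + ρ / (2 * L) ≤ ρ
    linarith
  have hη : IsMollifier (β.normed volume) ρ := β.isMollifier_normed.mono hle
  have mD : MeasurableSet (hypograph a ψ) := (isOpen_hypograph ha hψ).measurableSet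
  refine ⟨mollify (β.normed volume) v, hη.contDiff_mollify h.memLp,
    hη.hasCompactSupport_mollify hc, ?_, ?_⟩
  · exact (eLpNorm_mono_measure _ Measure.restrict_le_self).trans
      (H₁ _ (hη.mono (min_le_left _ _)))
  · refine le_trans (le_of_eq (eLpNorm_congr_ae ?_))
      ((eLpNorm_mono_measure _ Measure.restrict_le_self).trans (H₂ _ (hη.mono (min_le_right _ _))))
    filter_upwards [ae_restrict_mem mD] with x hx
    rw [gradient_mollify hη h]
    intro t ht
    rw [β.tsupport_normed_eq, mem_closedBall_iff_norm] at ht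
    have e : x - t = (x - (t - (ρ / 2) • a)) + (-(ρ / 2)) • a := by module
    have hx' : graphHeight a ψ x < 0 := hx
    change graphHeight a ψ (x - t) < 0
    rw [e, graphHeight_add_smul ha]
    have hlip := (lipschitzWith_graphHeight ha hψ).dist_le_mul (x - (t - (ρ / 2) • a)) x
    rw [Real.dist_eq, dist_eq_norm, sub_sub_cancel_left, norm_neg] at hlip
    push_cast at hlip
    rw [← hL] at hlip
    have h3 : L * ‖t - (ρ / 2) • a‖ ≤ ρ / 2 := by
      calc L * ‖t - (ρ / 2) • a‖ ≤ L * (ρ / (2 * L)) := by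
            exact mul_le_mul_of_nonneg_left ht (by linarith)
        _ = ρ / 2 := by field_simp
    have := le_abs_self (graphHeight a ψ (x - (t - (ρ / 2) • a)) - graphHeight a ψ x)
    linarith

/-- Composition with the fold does not increase the `H¹` norm by more than a constant factor. -/
theorem eLpNorm_gradient_comp_graphFold_le (ha : ‖a‖ = 1) (hψ : LipschitzWith K ψ) {f : Eu d → ℝ}
    (hf : Differentiable ℝ f) :
    eLpNorm (gradient fun x => f (graphFold a ψ x)) 2 volume ≤
      ((1 + 2 * (1 + 2 * K) : ℝ≥0) : ℝ≥0∞) *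
        (2 * eLpNorm (gradient f) 2 (volume.restrict (hypograph a ψ))) := by
  refine (eLpNorm_le_nnreal_smul_eLpNorm_of_ae_le_mul (g := fun x => gradient f (graphFold a ψ x))
    (.of_forall fun x => norm_gradient_comp_le hf (lipschitzWith_graphFold ha hψ) x) 2).trans ?_
  rw [ENNReal.smul_def, smul_eq_mul]
  gcongr
  exact eLpNorm_comp_graphFold_le ha hψ (stronglyMeasurable_gradient f)

theorem IsH1On.exists_extension_hypograph (ha : ‖a‖ = 1) (hψ : LipschitzWith K ψ) {v : Eu d → ℝ}
    {G : Eu d → Eu d} (h : IsH1On (hypograph a ψ) v G) (hc : HasCompactSupport v) :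
    ∃ w Gw, IsH1On univ w Gw ∧ ∀ᵐ x, x ∈ hypograph a ψ → w x = v x := by
  set D := hypograph a ψ with hD
  have mD : MeasurableSet D := (isOpen_hypograph ha hψ).measurableSet
  set R := graphFold a ψ with hR
  have hRL := lipschitzWith_graphFold ha hψ
  rw [← hR] at hRL
  set c : ℝ≥0 := 1 + 2 * (1 + 2 * K) with hcdef
  have hεpos : ∀ n : ℕ, (0 : ℝ≥0∞) < (2 ^ n)⁻¹ := fun n => by simp
  choose φ φ1 φ2 φ3 φ4 using fun n : ℕ => h.exists_smooth_approx ha hψ hc (hεpos n)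
  have φL : ∀ n, ∃ C, LipschitzWith C (fun x => φ n (R x)) := fun n => by
    obtain ⟨C, hC⟩ := (φ1 n).lipschitzWith_of_hasCompactSupport (φ2 n) (by simp)
    exact ⟨_, hC.comp hRL⟩
  have m1 : ∀ n, MemLp (fun x => φ n (R x)) 2 volume := fun n => by
    refine ⟨((φ1 n).continuous.comp hRL.continuous).aestronglyMeasurable, ?_⟩
    refine (eLpNorm_comp_graphFold_le ha hψ (φ1 n).continuous.stronglyMeasurable).trans_lt ?_
    refine ENNReal.mul_lt_top (by simp) ?_
    exact (((φ1 n).continuous.memLp_of_hasCompactSupport (φ2 n)).restrict _).2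
  have m2 : ∀ n, MemLp (gradient fun x => φ n (R x)) 2 volume := fun n => by
    refine ⟨(stronglyMeasurable_gradient _).aestronglyMeasurable, ?_⟩
    refine (eLpNorm_gradient_comp_graphFold_le ha hψ ((φ1 n).differentiable (by simp))).trans_lt ?_
    refine ENNReal.mul_lt_top ENNReal.coe_lt_top (ENNReal.mul_lt_top (by simp) ?_)
    have hg : HasCompactSupport (gradient (φ n)) := by
      have := ((φ2 n).fderiv ℝ)
      exact this.comp_left (g := (InnerProductSpace.toDual ℝ (Eu d)).symm) (map_zero _)
    exact (((φ1 n).continuous_gradient.memLp_of_hasCompactSupport hg).restrict _).2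
  have tri : ∀ {F : Type} [NormedAddCommGroup F] (f g k : Eu d → F) (n : ℕ),
      AEStronglyMeasurable f (volume.restrict D) → AEStronglyMeasurable g (volume.restrict D) →
      AEStronglyMeasurable k (volume.restrict D) →
      eLpNorm (fun x => f x - k x) 2 (volume.restrict D) ≤ (2 ^ n)⁻¹ →
      eLpNorm (fun x => g x - k x) 2 (volume.restrict D) ≤ (2 ^ (n + 1))⁻¹ →
      eLpNorm (fun x => f x - g x) 2 (volume.restrict D) ≤ 2 / 2 ^ n := by
    intro F _ f g k n hf hg hk h1 h2
    have e : (fun x => f x - g x) = (fun x => f x - k x) - fun x => g x - k x := by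
      funext x; simp
    rw [e]
    refine (eLpNorm_sub_le (hf.sub hk) (hg.sub hk) (by norm_num)).trans ?_
    calc _ ≤ ((2 : ℝ≥0∞) ^ n)⁻¹ + (2 ^ (n + 1))⁻¹ := add_le_add h1 h2
      _ ≤ (2 ^ n)⁻¹ + (2 ^ n)⁻¹ := by
        gcongr
        · norm_num
        · exact n.le_succ
      _ = 2 / 2 ^ n := by rw [div_eq_mul_inv, two_mul]
  have dn : ∀ n, Differentiable ℝ (φ n) := fun n => (φ1 n).differentiable (by simp)
  have c1 : CauchySeq fun n => (m1 n).toLp _ := by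
    refine cauchySeq_of_edist_le_geometric_two (C := 2 * 2) (by finiteness) fun n => ?_
    rw [Lp.edist_toLp_toLp]
    have := eLpNorm_comp_graphFold_le ha hψ
      ((φ1 n).continuous.sub (φ1 (n + 1)).continuous).stronglyMeasurable
    refine this.trans ?_
    rw [mul_div_assoc]
    gcongr
    exact tri _ _ v n (φ1 n).continuous.aestronglyMeasurable
      (φ1 (n + 1)).continuous.aestronglyMeasurable h.memLp.1.restrict (φ3 n) (φ3 (n + 1))
  have c2 : CauchySeq fun n => (m2 n).toLp _ := by
    refine cauchySeq_of_edist_le_geometric_two (C := c * (2 * 2)) (by finiteness) fun n => ?_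
    rw [Lp.edist_toLp_toLp]
    have e : (gradient fun x => φ n (R x)) - (gradient fun x => φ (n + 1) (R x)) =ᵐ[volume]
        gradient fun x => (fun y => φ n y - φ (n + 1) y) (R x) := by
      obtain ⟨C, hC⟩ := φL n
      obtain ⟨C', hC'⟩ := φL (n + 1)
      filter_upwards [hC.ae_differentiableAt (μ := volume),
        hC'.ae_differentiableAt (μ := volume)] with x hx hx'
      rw [Pi.sub_apply, gradient, gradient, gradient, fderiv_fun_sub hx hx', map_sub]
    rw [eLpNorm_congr_ae e]
    refine (eLpNorm_gradient_comp_graphFold_le ha hψ ((dn n).sub (dn (n + 1)))).trans ?_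
    rw [mul_div_assoc, mul_div_assoc]
    gcongr
    have e' : gradient (φ n - φ (n + 1)) = fun x => gradient (φ n) x - gradient (φ (n + 1)) x := by
      funext x
      rw [gradient, gradient, gradient, fderiv_sub (dn n x) (dn (n + 1) x), map_sub]
    rw [e']
    exact tri _ _ G n (stronglyMeasurable_gradient _).aestronglyMeasurable
      (stronglyMeasurable_gradient _).aestronglyMeasurable h.memLp_grad.1.restrict
      (φ4 n) (φ4 (n + 1))
  obtain ⟨A, hA⟩ := cauchySeq_tendsto_of_complete c1
  obtain ⟨B, hB⟩ := cauchySeq_tendsto_of_complete c2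
  have hlim : Tendsto (fun n => (WithLp.toLp 2 ((m1 n).toLp _, (m2 n).toLp _) : FunGrad d)) atTop
      (𝓝 (WithLp.toLp 2 (A, B))) :=
    ((WithLp.prod_continuous_toLp 2 _ _).tendsto (A, B)).comp (hA.prodMk_nhds hB)
  have hweak : IsWeakGradOn univ A B := by
    refine (isClosed_isWeakGradOn (univ : Set (Eu d))).mem_of_tendsto hlim (.of_forall fun n => ?_)
    obtain ⟨C, hC⟩ := φL n
    refine hC.isWeakGradOn.congr ?_ ?_
    · filter_upwards [(m1 n).coeFn_toLp] with x hx _ using hx.symm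
    · filter_upwards [(m2 n).coeFn_toLp] with x hx _ using hx.symm
  refine ⟨A, B, ⟨Lp.memLp A, Lp.memLp B, hweak⟩, ?_⟩
  have hz : eLpNorm (fun x => A x - v x) 2 (volume.restrict D) = 0 := by
    have hb : ∀ n, eLpNorm (fun x => A x - v x) 2 (volume.restrict D) ≤
        edist A ((m1 n).toLp _) + (2 ^ n)⁻¹ := by
      intro n
      have e : (fun x => A x - v x) =ᵐ[volume.restrict D]
          (⇑A - ⇑((m1 n).toLp _)) + fun x => φ n x - v x := by
        filter_upwards [ae_restrict_of_ae (m1 n).coeFn_toLp, ae_restrict_mem mD] with x hx hxD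
        have hx2 : R x = x := graphFold_of_nonpos (le_of_lt hxD)
        rw [Pi.add_apply, Pi.sub_apply, hx, hx2]; ring
      rw [eLpNorm_congr_ae e, Lp.edist_def]
      refine (eLpNorm_add_le ?_ ?_ (by norm_num)).trans (add_le_add ?_ (φ3 n))
      · exact ((Lp.aestronglyMeasurable A).sub (Lp.aestronglyMeasurable _)).restrict
      · exact (φ1 n).continuous.aestronglyMeasurable.sub h.memLp.1.restrict
      · exact eLpNorm_mono_measure _ Measure.restrict_le_self
    have t0 : Tendsto (fun n => edist A ((m1 n).toLp _) + ((2 : ℝ≥0∞) ^ n)⁻¹) atTop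
        (𝓝 (0 + 0)) := by
      refine Tendsto.add ?_ ?_
      · have := (tendsto_const_nhds (x := A)).edist hA
        rwa [edist_self] at this
      · simp_rw [ENNReal.inv_pow]
        exact ENNReal.tendsto_pow_atTop_nhds_zero_of_lt_one (by simp)
    rw [add_zero] at t0
    exact le_antisymm (ge_of_tendsto' t0 hb) zero_le
  have hz' := (eLpNorm_eq_zero_iff (((Lp.aestronglyMeasurable A).restrict).sub
    h.memLp.1.restrict) (by norm_num)).1 hz
  filter_upwards [(ae_restrict_iff' mD).1 hz'] with x hx hxD
  exact sub_eq_zero.1 (hx hxD)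

/-- Functions that are `H¹` outside a bounded Lipschitz open set extend to `H¹(ℝ^d)`. -/
theorem IsLipschitzOpen.exists_extension {U : Set (Eu d)} (hU : IsLipschitzOpen U)
    (hb : Bornology.IsBounded U) {v : Eu d → ℝ} {G : Eu d → Eu d}
    (h : IsH1On (closure U)ᶜ v G) :
    ∃ w Gw, IsH1On univ w Gw ∧ ∀ᵐ x, x ∈ (closure U)ᶜ → w x = v x := by
  set E := (closure U)ᶜ with hE
  have hEo : IsOpen E := isClosed_closure.isOpen_compl
  have hcpt : IsCompact (frontier U) :=
    Metric.isCompact_of_isClosed_isBounded isClosed_frontier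
      (hb.closure.subset frontier_subset_closure)
  have one_sub_bd : ∀ σ : Eu d → ℝ, ContDiff ℝ ∞ σ → HasCompactSupport σ →
      (∃ C, ∀ x, |1 - σ x| ≤ C) ∧ ∃ C, ∀ x, ‖gradient (fun x => 1 - σ x) x‖ ≤ C := by
    intro σ h1 h2
    obtain ⟨⟨C, hC⟩, ⟨C', hC'⟩⟩ := h1.exists_bound h2
    refine ⟨⟨1 + C, fun x => ?_⟩, ⟨C', fun x => ?_⟩⟩
    · have := abs_sub (1 : ℝ) (σ x)
      rw [abs_one] at this
      linarith [hC x]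
    · have := hC' x
      rwa [norm_gradient, fderiv_const_sub, norm_neg, ← norm_gradient]
  -- A partition of unity near the boundary, built one neighbourhood at a time.
  obtain ⟨σ, s1, s2, s3, s4⟩ : ∃ σ : Eu d → ℝ, ContDiff ℝ ∞ σ ∧ HasCompactSupport σ ∧
      (∀ᶠ x in 𝓝ˢ (frontier U), σ x = 1) ∧ ∀ v G, IsH1On E v G →
        ∃ w Gw, IsH1On univ w Gw ∧ ∀ᵐ x, x ∈ E → w x = σ x * v x := by
    refine hcpt.induction_on (p := fun s => ∃ σ : Eu d → ℝ, ContDiff ℝ ∞ σ ∧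
      HasCompactSupport σ ∧ (∀ᶠ x in 𝓝ˢ s, σ x = 1) ∧ ∀ v G, IsH1On E v G →
        ∃ w Gw, IsH1On univ w Gw ∧ ∀ᵐ x, x ∈ E → w x = σ x * v x) ?_ ?_ ?_ ?_
    · refine ⟨fun _ => 0, contDiff_const, HasCompactSupport.zero, by simp, fun v G _ => ?_⟩
      exact ⟨fun _ => 0, fun _ => 0, ⟨MemLp.zero', MemLp.zero', isWeakGradOn_const 0 _⟩,
        .of_forall fun x _ => by simp⟩
    · rintro s t hst ⟨σ, s1, s2, s3, s4⟩
      exact ⟨σ, s1, s2, s3.filter_mono (nhdsSet_mono hst), s4⟩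
    · rintro s t ⟨σ, s1, s2, s3, s4⟩ ⟨τ, t1, t2, t3, t4⟩
      refine ⟨fun x => σ x + (1 - σ x) * τ x, s1.add ((contDiff_const.sub s1).mul t1),
        s2.add t2.mul_left, ?_, fun v G h => ?_⟩
      · rw [nhdsSet_union, eventually_sup]
        constructor
        · filter_upwards [s3] with x hx
          rw [hx]; ring
        · filter_upwards [t3] with x hx
          rw [hx]; ring
      · obtain ⟨b1, b2⟩ := one_sub_bd σ s1 s2
        have h' := h.mul_smooth (U' := E) (contDiff_const.sub s1) b1 b2 inter_subset_right
        obtain ⟨w, Gw, hw, hwe⟩ := s4 v G h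
        obtain ⟨w', Gw', hw', hwe'⟩ := t4 _ _ h'
        refine ⟨_, _, hw.add hw', ?_⟩
        filter_upwards [hwe, hwe'] with x h1 h2 hx
        rw [h1 hx, h2 hx]; ring
    · intro p hp
      obtain ⟨r, hr, a, ha, K, ψ, hψ, hiff⟩ := hU.2 p hp
      have hiff' : ∀ y ∈ Metric.ball p r, (y ∈ U ↔ 0 < graphHeight a ψ y) := fun y hy => by
        rw [hiff y hy, graphHeight, sub_pos]
      have hDo := isOpen_hypograph ha hψ
      let χ : ContDiffBump p := ⟨r / 4, r / 2, by positivity, by linarith⟩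
      let χ' : ContDiffBump p := ⟨r / 2, 3 * r / 4, by positivity, by linarith⟩
      refine ⟨Metric.ball p (r / 4),
        mem_nhdsWithin_of_mem_nhds (Metric.ball_mem_nhds _ (by positivity)), χ, χ.contDiff,
        χ.hasCompactSupport, ?_, fun v G h => ?_⟩
      · rw [Metric.isOpen_ball.nhdsSet_eq, eventually_principal]
        exact fun x hx => χ.one_of_mem_closedBall (Metric.ball_subset_closedBall hx)
      obtain ⟨b1, b2⟩ := ContDiff.exists_bound χ.contDiff χ.hasCompactSupport
      obtain ⟨b1', b2'⟩ := ContDiff.exists_bound χ'.contDiff χ'.hasCompactSupport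
      have hDE : tsupport χ ∩ hypograph a ψ ⊆ E := by
        rintro x ⟨hx, hxD⟩ hxU
        rw [χ.tsupport_eq] at hx
        have hxb : x ∈ Metric.ball p r :=
          Metric.closedBall_subset_ball (show r / 2 < r by linarith) hx
        obtain ⟨y, ⟨hy, hyD⟩, hyU⟩ := mem_closure_iff.1 hxU _
          (Metric.isOpen_ball.inter hDo) ⟨hxb, hxD⟩
        exact lt_asymm ((hiff' y hy).1 hyU) hyD
      have hχ := h.mul_smooth χ.contDiff b1 b2 hDE
      obtain ⟨w, Gw, hw, hwe⟩ := hχ.exists_extension_hypograph ha hψ χ.hasCompactSupport.mul_right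
      refine ⟨_, _, hw.mul_smooth (U' := univ) χ'.contDiff b1' b2' (subset_univ _), ?_⟩
      have hz : ∀ᵐ x, graphHeight a ψ x ≠ 0 := by
        rw [ae_iff]
        simpa using volume_graph_eq_zero ha hψ
      -- The reflected function may leave the support of `χ`, hence the second cutoff.
      filter_upwards [hwe, hz] with x hx hx0 hxE
      by_cases hxb : x ∈ Metric.ball p (3 * r / 4)
      · have hxr : x ∈ Metric.ball p r := Metric.ball_subset_ball (by linarith) hxb
        have hxU : x ∉ U := fun h' => hxE (subset_closure h')
        rw [hiff' x hxr, not_lt] at hxU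
        rw [hx (lt_of_le_of_ne hxU hx0), ← mul_assoc]
        by_cases hx2 : x ∈ Metric.closedBall p (r / 2)
        · rw [χ'.one_of_mem_closedBall hx2, one_mul]
        · rw [χ.zero_of_le_dist (le_of_lt (not_le.1 hx2))]; ring
      · have h1 : 3 * r / 4 ≤ dist x p := not_lt.1 hxb
        rw [χ'.zero_of_le_dist h1, χ.zero_of_le_dist (show r / 2 ≤ dist x p by linarith)]
        ring
  obtain ⟨w, Gw, hw, hwe⟩ := s4 v G h
  obtain ⟨⟨C, hC⟩, ⟨C', hC'⟩⟩ := one_sub_bd σ s1 s2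
  -- What remains of `v` vanishes near the boundary, so that extension by zero is enough.
  set χ : Eu d → ℝ := E.indicator fun x => 1 - σ x with hχ
  have χE : ∀ x ∈ E, χ =ᶠ[𝓝 x] fun x => 1 - σ x := fun x hx => by
    filter_upwards [hEo.mem_nhds hx] with y hy using indicator_of_mem hy _
  have χ0 : ∀ x ∉ E, χ =ᶠ[𝓝 x] fun _ => 0 := fun x hx => by
    rw [hE, notMem_compl_iff] at hx
    by_cases hxU : x ∈ U
    · filter_upwards [hU.1.mem_nhds hxU] with y hy
      exact indicator_of_notMem (notMem_compl_iff.2 (subset_closure hy)) _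
    · have hxf : x ∈ frontier U := by rw [hU.1.frontier_eq]; exact ⟨hx, hxU⟩
      filter_upwards [s3.filter_mono (nhds_le_nhdsSet hxf)] with y hy
      simp [hχ, indicator, hy]
  have χc : ContDiff ℝ ∞ χ := contDiff_iff_contDiffAt.2 fun x => by
    by_cases hx : x ∈ E
    · exact (contDiff_const.sub s1).contDiffAt.congr_of_eventuallyEq (χE x hx)
    · exact contDiffAt_const.congr_of_eventuallyEq (χ0 x hx)
  have χs : tsupport χ ∩ univ ⊆ E := by
    rintro x ⟨hx, -⟩
    by_contra hxE
    exact (notMem_tsupport_iff_eventuallyEq.2 (χ0 x hxE)) hx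
  have hfin := h.mul_smooth (U' := univ) χc ⟨C, fun x => ?_⟩ ⟨C', fun x => ?_⟩ χs
  · refine ⟨_, _, hw.add hfin, ?_⟩
    filter_upwards [hwe] with x hx hxE
    rw [hx hxE, (χE x hxE).self_of_nhds]; ring
  · by_cases hx : x ∈ E
    · rw [(χE x hx).self_of_nhds]; exact hC x
    · rw [(χ0 x hx).self_of_nhds, abs_zero]; exact (abs_nonneg _).trans (hC x)
  · by_cases hx : x ∈ E
    · rw [(χE x hx).gradient_eq]; exact hC' x
    · rw [(χ0 x hx).gradient_eq, gradient_fun_const, norm_zero]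
      exact (norm_nonneg _).trans (hC' x)

end Extension

/-! ### The energy and mass forms -/

section Forms

variable {d : ℕ}

/-- The bilinear form `∫_A ∇p·∇q`. -/
noncomputable def gradForm (A : Set (Eu d)) : FunGrad d →L[ℝ] FunGrad d →L[ℝ] ℝ :=
  let T : FunGrad d →L[ℝ] Lp (Eu d) 2 (volume.restrict A) :=
    (LpToLpRestrictCLM (Eu d) (Eu d) ℝ volume 2 A).comp (WithLp.sndL 2 ℝ _ _)
  (innerSL ℝ).bilinearComp T T

/-- The bilinear form `∫_A p q`. -/
noncomputable def massForm (A : Set (Eu d)) : FunGrad d →L[ℝ] FunGrad d →L[ℝ] ℝ :=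
  let T : FunGrad d →L[ℝ] Lp ℝ 2 (volume.restrict A) :=
    (LpToLpRestrictCLM (Eu d) ℝ ℝ volume 2 A).comp (WithLp.fstL 2 ℝ _ _)
  (innerSL ℝ).bilinearComp T T

theorem gradForm_apply (A : Set (Eu d)) (p q : FunGrad d) :
    gradForm A p q = ∫ x in A, ⟪p.snd x, q.snd x⟫_ℝ := by
  change ⟪LpToLpRestrictCLM (Eu d) (Eu d) ℝ volume 2 A p.snd,
    LpToLpRestrictCLM (Eu d) (Eu d) ℝ volume 2 A q.snd⟫_ℝ = _
  rw [L2.inner_def]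
  refine integral_congr_ae ?_
  filter_upwards [LpToLpRestrictCLM_coeFn ℝ A p.snd, LpToLpRestrictCLM_coeFn ℝ A q.snd] with x h1 h2
  rw [h1, h2]

theorem massForm_apply (A : Set (Eu d)) (p q : FunGrad d) :
    massForm A p q = ∫ x in A, p.fst x * q.fst x := by
  change ⟪LpToLpRestrictCLM (Eu d) ℝ ℝ volume 2 A p.fst,
    LpToLpRestrictCLM (Eu d) ℝ ℝ volume 2 A q.fst⟫_ℝ = _
  rw [L2.inner_def]
  refine integral_congr_ae ?_
  filter_upwards [LpToLpRestrictCLM_coeFn ℝ A p.fst, LpToLpRestrictCLM_coeFn ℝ A q.fst] with x h1 h2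
  rw [h1, h2]
  simp [mul_comm]

theorem gradForm_self_nonneg (A : Set (Eu d)) (p : FunGrad d) : 0 ≤ gradForm A p p := by
  rw [gradForm_apply]
  exact integral_nonneg fun x => real_inner_self_nonneg

theorem massForm_self_nonneg (A : Set (Eu d)) (p : FunGrad d) : 0 ≤ massForm A p p := by
  rw [massForm_apply]
  exact integral_nonneg fun x => mul_self_nonneg _

theorem gradForm_congr {A : Set (Eu d)} (hA : MeasurableSet A) {p q p' q' : FunGrad d}
    (hp : ∀ᵐ x, x ∈ A → p.snd x = p'.snd x) (hq : ∀ᵐ x, x ∈ A → q.snd x = q'.snd x) :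
    gradForm A p q = gradForm A p' q' := by
  rw [gradForm_apply, gradForm_apply]
  refine setIntegral_congr_ae hA ?_
  filter_upwards [hp, hq] with x h1 h2 hx
  rw [h1 hx, h2 hx]

theorem massForm_congr {A : Set (Eu d)} (hA : MeasurableSet A) {p q p' q' : FunGrad d}
    (hp : ∀ᵐ x, x ∈ A → p.fst x = p'.fst x) (hq : ∀ᵐ x, x ∈ A → q.fst x = q'.fst x) :
    massForm A p q = massForm A p' q' := by
  rw [massForm_apply, massForm_apply]
  refine setIntegral_congr_ae hA ?_
  filter_upwards [hp, hq] with x h1 h2 hx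
  rw [h1 hx, h2 hx]

theorem ae_coeFn_zero (F : Type*) [NormedAddCommGroup F] :
    ∀ᵐ x, (0 : Lp F 2 (volume : Measure (Eu d))) x = 0 := Lp.coeFn_zero F 2 volume

theorem gradForm_eq_zero_left {A : Set (Eu d)} (hA : MeasurableSet A) {p : FunGrad d}
    (hp : ∀ᵐ x, x ∈ A → p.snd x = 0) (q : FunGrad d) : gradForm A p q = 0 := by
  rw [gradForm_congr hA (p' := 0) (q' := q) ?_ (.of_forall fun _ _ => rfl), map_zero]
  · rfl
  · filter_upwards [hp, ae_coeFn_zero (Eu d)] with x h1 h2 hx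
    rw [h1 hx]; exact h2.symm

theorem gradForm_eq_zero_right {A : Set (Eu d)} (hA : MeasurableSet A) {q : FunGrad d}
    (hq : ∀ᵐ x, x ∈ A → q.snd x = 0) (p : FunGrad d) : gradForm A p q = 0 := by
  rw [gradForm_congr hA (p' := p) (q' := 0) (.of_forall fun _ _ => rfl) ?_, map_zero]
  filter_upwards [hq, ae_coeFn_zero (Eu d)] with x h1 h2 hx
  rw [h1 hx]; exact h2.symm

theorem massForm_eq_zero_left {A : Set (Eu d)} (hA : MeasurableSet A) {p : FunGrad d}
    (hp : ∀ᵐ x, x ∈ A → p.fst x = 0) (q : FunGrad d) : massForm A p q = 0 := by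
  rw [massForm_congr hA (p' := 0) (q' := q) ?_ (.of_forall fun _ _ => rfl), map_zero]
  · rfl
  · filter_upwards [hp, ae_coeFn_zero ℝ] with x h1 h2 hx
    rw [h1 hx]; exact h2.symm

theorem ae_eq_zero_of_gradForm_self {A : Set (Eu d)} (hA : MeasurableSet A) {p : FunGrad d}
    (hp : gradForm A p p = 0) : ∀ᵐ x, x ∈ A → p.snd x = 0 := by
  rw [gradForm_apply] at hp
  have hint : Integrable (fun x => ⟪p.snd x, p.snd x⟫_ℝ) := L2.integrable_inner p.snd p.snd
  have := (setIntegral_eq_zero_iff_of_nonneg_ae (.of_forall fun x => real_inner_self_nonneg)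
    hint.integrableOn).1 hp
  filter_upwards [(ae_restrict_iff' hA).1 this] with x hx hxA
  exact inner_self_eq_zero.1 (hx hxA)

theorem ae_eq_zero_of_massForm_self {A : Set (Eu d)} (hA : MeasurableSet A) {p : FunGrad d}
    (hp : massForm A p p = 0) : ∀ᵐ x, x ∈ A → p.fst x = 0 := by
  rw [massForm_apply] at hp
  have hint : Integrable (fun x => p.fst x * p.fst x) :=
    (Lp.memLp p.fst).integrable_mul (Lp.memLp p.fst)
  have := (setIntegral_eq_zero_iff_of_nonneg_ae (.of_forall fun x => mul_self_nonneg _)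
    hint.integrableOn).1 hp
  filter_upwards [(ae_restrict_iff' hA).1 this] with x hx hxA
  exact mul_self_eq_zero.1 (hx hxA)

theorem sq_gradForm_le (A : Set (Eu d)) (p q : FunGrad d) :
    gradForm A p q ^ 2 ≤ gradForm A p p * gradForm A q q := by
  rw [sq]
  exact real_inner_mul_inner_self_le (LpToLpRestrictCLM (Eu d) (Eu d) ℝ volume 2 A p.snd)
    (LpToLpRestrictCLM (Eu d) (Eu d) ℝ volume 2 A q.snd)

theorem weightedForm_eq {N : ℕ} (Ω : Set (Eu d)) (cell : Fin N → Set (Eu d)) (l : Fin N → ℝ≥0∞)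
    (p q : FunGrad d) : weightedForm Ω cell l p q =
      (∑ i, (l i).toReal * gradForm (cell i) p q) + massForm Ω p q := by
  simp only [weightedForm, gradForm_apply, massForm_apply]

/-- The restriction of a function and its gradient to a measurable set, extended by zero. -/
noncomputable def cutOff {A : Set (Eu d)} (hA : MeasurableSet A) (p : FunGrad d) : FunGrad d :=
  WithLp.toLp 2 (((Lp.memLp p.fst).indicator hA).toLp _, ((Lp.memLp p.snd).indicator hA).toLp _)

theorem cutOff_fst {A : Set (Eu d)} (hA : MeasurableSet A) (p : FunGrad d) :
    ∀ᵐ x, (cutOff hA p).fst x = A.indicator p.fst x :=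
  ((Lp.memLp p.fst).indicator hA).coeFn_toLp

theorem cutOff_snd {A : Set (Eu d)} (hA : MeasurableSet A) (p : FunGrad d) :
    ∀ᵐ x, (cutOff hA p).snd x = A.indicator p.snd x :=
  ((Lp.memLp p.snd).indicator hA).coeFn_toLp

theorem isClosed_ae_eq_zero {F : Type*} [NormedAddCommGroup F] [NormedSpace ℝ F]
    {A : Set (Eu d)} (hA : MeasurableSet A) :
    IsClosed {f : Lp F 2 (volume : Measure (Eu d)) | ∀ᵐ x, x ∈ A → f x = 0} := by
  have : {f : Lp F 2 (volume : Measure (Eu d)) | ∀ᵐ x, x ∈ A → f x = 0} =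
      {f | LpToLpRestrictCLM (Eu d) F ℝ volume 2 A f = 0} := by
    ext f
    rw [mem_ofPred_eq, mem_ofPred_eq, Lp.eq_zero_iff_ae_eq_zero, ← ae_restrict_iff' hA]
    constructor
    · intro h
      exact (LpToLpRestrictCLM_coeFn ℝ A f).trans h
    · intro h
      exact (LpToLpRestrictCLM_coeFn ℝ A f).symm.trans h
  rw [this]
  exact isClosed_eq (ContinuousLinearMap.continuous _) continuous_const

theorem isClosed_ae_eq_const {A : Set (Eu d)} (hA : MeasurableSet A) (hfin : volume A < ⊤) :
    IsClosed {f : Lp ℝ 2 (volume : Measure (Eu d)) | ∃ C : ℝ, ∀ᵐ x, x ∈ A → f x = C} := by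
  have : IsFiniteMeasure ((volume : Measure (Eu d)).restrict A) :=
    ⟨by rwa [Measure.restrict_apply_univ]⟩
  have h1 : MemLp (fun _ : Eu d => (1 : ℝ)) 2 (volume.restrict A) := memLp_const 1
  have : {f : Lp ℝ 2 (volume : Measure (Eu d)) | ∃ C : ℝ, ∀ᵐ x, x ∈ A → f x = C} =
      LpToLpRestrictCLM (Eu d) ℝ ℝ volume 2 A ⁻¹' (Submodule.span ℝ {h1.toLp _}) := by
    ext f
    rw [mem_ofPred_eq, mem_preimage, SetLike.mem_coe, Submodule.mem_span_singleton]
    refine exists_congr fun C => ?_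
    rw [← ae_restrict_iff' hA]
    constructor
    · intro h
      refine Lp.ext ?_
      filter_upwards [LpToLpRestrictCLM_coeFn ℝ A f, h, Lp.coeFn_smul C (h1.toLp _),
        h1.coeFn_toLp] with x e1 e2 e3 e4
      rw [e1, e2, e3, Pi.smul_apply, e4, smul_eq_mul, mul_one]
    · intro h
      have e0 := LpToLpRestrictCLM_coeFn ℝ A f
      rw [← h] at e0
      filter_upwards [e0, Lp.coeFn_smul C (h1.toLp _), h1.coeFn_toLp] with x e1 e3 e4
      rw [← e1, e3, Pi.smul_apply, e4, smul_eq_mul, mul_one]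
  rw [this]
  exact (Submodule.closed_of_finiteDimensional _).preimage (ContinuousLinearMap.continuous _)

end Forms

/-! ### Broken Sobolev spaces on a Lipschitz partition -/

section Partition

variable {d N : ℕ} {Ω : Set (Eu d)} {cell : Fin N → Set (Eu d)} {S K J : Set (Fin N)}

namespace IsLipschitzPartition

theorem isOpen_cell (hpart : IsLipschitzPartition Ω cell) (i : Fin N) : IsOpen (cell i) :=
  (hpart.cell_lipschitz i).1

theorem measurableSet_cell (hpart : IsLipschitzPartition Ω cell) (i : Fin N) :
    MeasurableSet (cell i) := (hpart.isOpen_cell i).measurableSet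

theorem measurableSet (hpart : IsLipschitzPartition Ω cell) : MeasurableSet Ω :=
  hpart.lipschitz.1.measurableSet

theorem disjoint_closure (hpart : IsLipschitzPartition Ω cell) {i j : Fin N} (h : i ≠ j) :
    Disjoint (cell i) (closure (cell j)) :=
  (hpart.cell_disjoint i j h).closure_right (hpart.isOpen_cell i)

theorem cell_subset_awayFrom (hpart : IsLipschitzPartition Ω cell) {i : Fin N} {A : Set (Fin N)}
    (hi : i ∈ A) : cell i ⊆ awayFrom cell A := by
  intro x hx hx'
  obtain ⟨j, hj, hxj⟩ := mem_iUnion₂.1 hx'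
  exact disjoint_left.1 (hpart.disjoint_closure (fun h : i = j => hj (h ▸ hi))) hx hxj

theorem notMem_cell_of_mem_awayFrom {i : Fin N} {A : Set (Fin N)} (hi : i ∉ A) {x : Eu d}
    (hx : x ∈ awayFrom cell A) : x ∉ cell i :=
  fun h => hx (mem_iUnion₂.2 ⟨i, hi, subset_closure h⟩)

theorem ae_mem_cell (hpart : IsLipschitzPartition Ω cell) : ∀ᵐ x, x ∈ Ω → ∃ i, x ∈ cell i := by
  rw [ae_iff]
  refine measure_mono_null (fun x hx => ?_) hpart.cover
  simp only [mem_ofPred_eq, not_forall, not_exists] at hx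
  exact ⟨hx.1, fun h => by obtain ⟨i, hi⟩ := mem_iUnion.1 h; exact hx.2 i hi⟩

theorem volume_cell_lt_top (hpart : IsLipschitzPartition Ω cell) (i : Fin N) :
    volume (cell i) < ⊤ :=
  (hpart.bounded.subset (hpart.cell_subset i)).measure_lt_top

end IsLipschitzPartition

open IsLipschitzPartition

theorem mem_brokenSobolev {p : FunGrad d} : p ∈ brokenSobolev Ω cell S K ↔
    (∀ᵐ x, x ∉ Ω → p.fst x = 0) ∧
    (∀ᵐ x, x ∉ (⋃ i, cell i) → p.snd x = 0) ∧
    IsWeakGradOn (awayFrom cell Sᶜ) p.fst p.snd ∧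
    (∀ i ∈ S, IsWeakGradOn (awayFrom cell {i}) p.fst p.snd) ∧
    (∀ i ∈ K, ∃ C : ℝ, ∀ᵐ x, x ∈ cell i → p.fst x = C) := Iff.rfl

theorem isWeakGradOn_awayFrom_singleton {p : FunGrad d} (hp : p ∈ brokenSobolev Ω cell S K)
    (i : Fin N) : IsWeakGradOn (awayFrom cell {i}) p.fst p.snd := by
  obtain ⟨-, -, h3, h4, -⟩ := hp
  by_cases h : i ∈ S
  · exact h4 i h
  · exact h3.mono (awayFrom_mono _ (singleton_subset_iff.2 h))

theorem isWeakGradOn_cell (hpart : IsLipschitzPartition Ω cell) {p : FunGrad d}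
    (hp : p ∈ brokenSobolev Ω cell S K) (i : Fin N) : IsWeakGradOn (cell i) p.fst p.snd :=
  (isWeakGradOn_awayFrom_singleton hp i).mono (hpart.cell_subset_awayFrom rfl)

theorem ae_snd_eq_zero_of_const (hpart : IsLipschitzPartition Ω cell) {p : FunGrad d}
    (hp : p ∈ brokenSobolev Ω cell S K) {i : Fin N} {C : ℝ}
    (hC : ∀ᵐ x, x ∈ cell i → p.fst x = C) : ∀ᵐ x, x ∈ cell i → p.snd x = 0 :=
  (isWeakGradOn_cell hpart hp i).ae_eq_zero (hpart.isOpen_cell i) (Lp.memLp _) hC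

/-- Elements of `𝓗` are determined by the function on `Ω`. -/
theorem eq_zero_of_ae_fst_eq_zero (hpart : IsLipschitzPartition Ω cell) {p : FunGrad d}
    (hp : p ∈ brokenSobolev Ω cell S K) (h : ∀ᵐ x, x ∈ Ω → p.fst x = 0) : p = 0 := by
  have h1 : p.fst = 0 := by
    rw [Lp.eq_zero_iff_ae_eq_zero]
    filter_upwards [h, hp.1] with x h1 h2
    by_cases hx : x ∈ Ω
    · exact h1 hx
    · exact h2 hx
  have h2 : p.snd = 0 := by
    rw [Lp.eq_zero_iff_ae_eq_zero]
    have : ∀ i, ∀ᵐ x, x ∈ cell i → p.snd x = 0 := fun i =>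
      ae_snd_eq_zero_of_const hpart hp (C := 0) (by
        filter_upwards [h] with x hx hxi using hx (hpart.cell_subset i hxi))
    filter_upwards [ae_all_iff.2 this, hp.2.1] with x h3 h4
    by_cases hx : x ∈ ⋃ i, cell i
    · obtain ⟨i, hi⟩ := mem_iUnion.1 hx
      exact h3 i hi
    · exact h4 hx
  exact WithLp.ofLp_injective 2 (Prod.ext h1 h2)

/-- The square of the norm of `𝓗` is the sum of the mass form and the energies in the cells. -/
theorem norm_sq_eq (hpart : IsLipschitzPartition Ω cell) {p : FunGrad d}
    (hp : p ∈ brokenSobolev Ω cell S K) :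
    ‖p‖ ^ 2 = (∑ i, gradForm (cell i) p p) + massForm Ω p p := by
  rw [← real_inner_self_eq_norm_sq, WithLp.prod_inner_apply, L2.inner_def, L2.inner_def, add_comm]
  congr 1
  · have hint : Integrable (fun x => ⟪p.snd x, p.snd x⟫_ℝ) := L2.integrable_inner p.snd p.snd
    simp only [gradForm_apply]
    rw [← integral_iUnion_fintype (fun i => hpart.measurableSet_cell i)
      (fun i j hij => hpart.cell_disjoint i j hij) fun i => hint.integrableOn]
    refine (setIntegral_eq_integral_of_ae_compl_eq_zero ?_).symm
    filter_upwards [hp.2.1] with x hx hx'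
    change ⟪p.snd x, p.snd x⟫_ℝ = 0
    rw [hx hx', inner_zero_left]
  · rw [massForm_apply]
    rw [setIntegral_eq_integral_of_ae_compl_eq_zero]
    · refine integral_congr_ae (.of_forall fun x => ?_)
      change ⟪p.fst x, p.fst x⟫_ℝ = p.fst x * p.fst x
      simp [sq]
    · filter_upwards [hp.1] with x hx hx'
      rw [hx hx', zero_mul]

theorem isClosed_brokenSobolev (hpart : IsLipschitzPartition Ω cell) (S K : Set (Fin N)) :
    IsClosed (brokenSobolev Ω cell S K : Set (FunGrad d)) := by
  have hU : MeasurableSet (⋃ i, cell i) :=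
    MeasurableSet.iUnion fun i => hpart.measurableSet_cell i
  have hf : Continuous fun p : FunGrad d => p.fst := (WithLp.fstL 2 ℝ _ _).continuous
  have hs : Continuous fun p : FunGrad d => p.snd := (WithLp.sndL 2 ℝ _ _).continuous
  have h1 := (isClosed_ae_eq_zero (F := ℝ) hpart.measurableSet.compl).preimage hf
  have h2 := (isClosed_ae_eq_zero (F := Eu d) hU.compl).preimage hs
  have h3 := isClosed_isWeakGradOn (awayFrom cell Sᶜ)
  have h4 : IsClosed (⋂ i ∈ S, {p : FunGrad d | IsWeakGradOn (awayFrom cell {i}) p.fst p.snd}) :=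
    isClosed_biInter fun i _ => isClosed_isWeakGradOn _
  have h5 : IsClosed (⋂ i ∈ K, {p : FunGrad d | ∃ C : ℝ, ∀ᵐ x, x ∈ cell i → p.fst x = C}) :=
    isClosed_biInter fun i _ =>
      (isClosed_ae_eq_const (hpart.measurableSet_cell i) (hpart.volume_cell_lt_top i)).preimage hf
  have := h1.inter (h2.inter (h3.inter (h4.inter h5)))
  convert this using 1
  ext p
  simp only [SetLike.mem_coe, mem_brokenSobolev, mem_inter_iff, mem_preimage, mem_iInter,
    mem_ofPred_eq, mem_compl_iff]

theorem completeSpace_brokenSobolev (hpart : IsLipschitzPartition Ω cell) (S K : Set (Fin N)) :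
    CompleteSpace (brokenSobolev Ω cell S K) :=
  (isClosed_brokenSobolev hpart S K).completeSpace_coe

/-- A function in `H¹(cell i)` that vanishes on `∂Ω` may be used as soon as jumps across the
boundary of `cell i` are allowed. -/
theorem cellSobolev_subset (hpart : IsLipschitzPartition Ω cell) {i : Fin N} (hS : i ∈ S)
    (hK : i ∉ K) {w : FunGrad d} (hw : w ∈ cellSobolev cell i) : w ∈ brokenSobolev Ω cell S K := by
  obtain ⟨w1, w2, w3⟩ := hw
  have hzero : ∀ A : Set (Fin N), i ∉ A → IsWeakGradOn (awayFrom cell A) w.fst w.snd := by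
    intro A hA
    refine (isWeakGradOn_const 0 _).congr ?_ ?_
    · filter_upwards [w1] with x hx hxA
      exact (hx (notMem_cell_of_mem_awayFrom hA hxA)).symm
    · filter_upwards [w2] with x hx hxA
      exact (hx (notMem_cell_of_mem_awayFrom hA hxA)).symm
  refine ⟨?_, ?_, hzero _ (fun h => h hS), fun j _ => ?_, fun k hk => ⟨0, ?_⟩⟩
  · filter_upwards [w1] with x hx hxΩ using hx fun h => hxΩ (hpart.cell_subset i h)
  · filter_upwards [w2] with x hx hxU using hx fun h => hxU (mem_iUnion.2 ⟨i, h⟩)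
  · by_cases hij : j = i
    · exact hij ▸ w3
    · exact hzero _ (fun h => hij (mem_singleton_iff.1 h).symm)
  · filter_upwards [w1] with x hx hxk
    have hik : i ≠ k := fun h => hK (h ▸ hk)
    exact hx fun h => disjoint_left.1 (hpart.cell_disjoint i k hik) h hxk

theorem cutOff_mem_cellSobolev (hpart : IsLipschitzPartition Ω cell) {p : FunGrad d}
    (hp : p ∈ brokenSobolev Ω cell S K) (i : Fin N) :
    cutOff (hpart.measurableSet_cell i) p ∈ cellSobolev cell i := by
  have c1 := cutOff_fst (hpart.measurableSet_cell i) p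
  have c2 := cutOff_snd (hpart.measurableSet_cell i) p
  have hnot : ∀ x ∈ awayFrom cell {i}, x ∉ cell i → x ∉ ⋃ j, cell j := by
    intro x hx hxi h
    obtain ⟨j, hj⟩ := mem_iUnion.1 h
    by_cases hij : j = i
    · exact hxi (hij ▸ hj)
    · exact notMem_cell_of_mem_awayFrom (show j ∉ ({i} : Set (Fin N)) from hij) hx hj
  refine ⟨?_, ?_, (isWeakGradOn_awayFrom_singleton hp i).congr ?_ ?_⟩
  · filter_upwards [c1] with x hx hxi
    rw [hx, indicator_of_notMem hxi]
  · filter_upwards [c2] with x hx hxi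
    rw [hx, indicator_of_notMem hxi]
  · filter_upwards [c1, hp.1, hpart.ae_mem_cell] with x hx h1 h2 hxA
    rw [hx]
    by_cases hxi : x ∈ cell i
    · rw [indicator_of_mem hxi]
    · rw [indicator_of_notMem hxi, h1 fun hΩ => hnot x hxA hxi (mem_iUnion.2 (h2 hΩ))]
  · filter_upwards [c2, hp.2.1] with x hx h1 hxA
    rw [hx]
    by_cases hxi : x ∈ cell i
    · rw [indicator_of_mem hxi]
    · rw [indicator_of_notMem hxi, h1 (hnot x hxA hxi)]

end Partition

/-! ### Existence and uniqueness of the degenerate gradient -/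

section DegenerateGradient

open IsLipschitzPartition

variable {d N : ℕ} {Ω : Set (Eu d)} {cell : Fin N → Set (Eu d)} {S K J : Set (Fin N)}

/-- The Lax–Milgram theorem. -/
theorem IsCoercive.exists_forall_eq {H : Type*} [NormedAddCommGroup H] [InnerProductSpace ℝ H]
    [CompleteSpace H] {B : H →L[ℝ] H →L[ℝ] ℝ} (hB : IsCoercive B) (T : H →L[ℝ] ℝ) :
    ∃ h, ∀ v, B h v = T v := by
  refine ⟨hB.continuousLinearEquivOfBilin.symm ((InnerProductSpace.toDual ℝ H).symm T),
    fun v => ?_⟩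
  rw [← hB.continuousLinearEquivOfBilin_apply, ContinuousLinearEquiv.apply_symm_apply,
    InnerProductSpace.toDual_symm_apply]

theorem massForm_of_cell (hpart : IsLipschitzPartition Ω cell) {i : Fin N} (p : FunGrad d)
    {q : FunGrad d} (hq : ∀ᵐ x, x ∉ cell i → q.fst x = 0) :
    massForm Ω p q = massForm (cell i) p q := by
  rw [massForm_apply, massForm_apply]
  refine (setIntegral_eq_of_subset_of_ae_sdiff_eq_zero hpart.measurableSet.nullMeasurableSet
    (hpart.cell_subset i) ?_)
  filter_upwards [hq] with x hx hx'
  rw [hx hx'.2, mul_zero]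

theorem massForm_comm (A : Set (Eu d)) (p q : FunGrad d) : massForm A p q = massForm A q p := by
  simp only [massForm_apply, mul_comm]

theorem ae_eq_zero_of_ne (hpart : IsLipschitzPartition Ω cell) {i j : Fin N} (hij : j ≠ i)
    {F : Type*} [Zero F] {f : Eu d → F} (hf : ∀ᵐ x, x ∉ cell i → f x = 0) :
    ∀ᵐ x, x ∈ cell j → f x = 0 := by
  filter_upwards [hf] with x hx hxj
  exact hx fun h => disjoint_left.1 (hpart.cell_disjoint j i hij) hxj h

/-- Against functions living in one cell of zero weight, only the mass term is seen. -/
theorem weightedForm_of_cell (hpart : IsLipschitzPartition Ω cell) {l : Fin N → ℝ≥0∞}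
    {i : Fin N} (hi : l i = 0) (p : FunGrad d) {q : FunGrad d}
    (h1 : ∀ᵐ x, x ∉ cell i → q.fst x = 0) (h2 : ∀ᵐ x, x ∉ cell i → q.snd x = 0) :
    weightedForm Ω cell l p q = massForm (cell i) p q := by
  rw [weightedForm_eq, massForm_of_cell hpart p h1, Finset.sum_eq_zero, zero_add]
  intro j _
  by_cases hj : j = i
  · rw [hj, hi, ENNReal.toReal_zero, zero_mul]
  · rw [gradForm_eq_zero_right (hpart.measurableSet_cell j) (ae_eq_zero_of_ne hpart hj h2), mul_zero]

theorem ae_snd_eq_zero_of_mem (hpart : IsLipschitzPartition Ω cell) {p : FunGrad d}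
    (hp : p ∈ brokenSobolev Ω cell S K) {i : Fin N} (hi : i ∈ K) :
    ∀ᵐ x, x ∈ cell i → p.snd x = 0 := by
  obtain ⟨C, hC⟩ := hp.2.2.2.2 i hi
  exact ae_snd_eq_zero_of_const hpart hp hC

theorem IsDegenerateGradient.unique (hpart : IsLipschitzPartition Ω cell)
    {L : BrokenH Ω cell J → ℝ} {l : Fin N → ℝ≥0∞} {g g' : BrokenH Ω cell J}
    (h : IsDegenerateGradient L l g) (h' : IsDegenerateGradient L l g') : g = g' := by
  have hz : ((g - g' : BrokenH Ω cell J) : FunGrad d) ∈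
      brokenSobolev Ω cell (zeroSet l) (inftySet l) := by
    rw [Submodule.coe_sub]
    exact Submodule.sub_mem _ h.1 h'.1
  have e1 := h.2 _ hz
  have e2 := h'.2 _ hz
  set z : BrokenH Ω cell J := g - g' with hzdef
  have e3 : weightedForm Ω cell l z z = 0 := by
    have : weightedForm Ω cell l z z =
        weightedForm Ω cell l g z - weightedForm Ω cell l g' z := by
      simp only [weightedForm_eq]
      have hc : (z : FunGrad d) = (g : FunGrad d) - (g' : FunGrad d) := by
        rw [hzdef, Submodule.coe_sub]
      have hG : ∀ A, gradForm A (z : FunGrad d) z =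
          gradForm A (g : FunGrad d) z - gradForm A (g' : FunGrad d) z := fun A => by
        rw [← (gradForm A).map_sub₂, ← hc]
      have hM : massForm Ω (z : FunGrad d) z =
          massForm Ω (g : FunGrad d) z - massForm Ω (g' : FunGrad d) z := by
        rw [← (massForm Ω).map_sub₂, ← hc]
      rw [hM]
      simp only [hG, mul_sub, Finset.sum_sub_distrib]
      ring
    rw [this, e1, e2, sub_self]
  rw [weightedForm_eq] at e3
  have e4 : massForm Ω (z : FunGrad d) z = 0 := by
    have hs : 0 ≤ ∑ i, (l i).toReal * gradForm (cell i) (z : FunGrad d) z :=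
      Finset.sum_nonneg fun i _ => mul_nonneg ENNReal.toReal_nonneg (gradForm_self_nonneg _ _)
    linarith [massForm_self_nonneg Ω (z : FunGrad d)]
  have e5 := ae_eq_zero_of_massForm_self hpart.measurableSet e4
  have e6 : (z : FunGrad d) = 0 := eq_zero_of_ae_fst_eq_zero hpart hz e5
  have e7 : z = 0 := by exact_mod_cast e6
  exact sub_eq_zero.1 e7

/-- Lax–Milgram in the broken Sobolev spaces, for positive finite weights. -/
theorem exists_forall_weighted_eq (hpart : IsLipschitzPartition Ω cell) (hS : S ⊆ J)
    (L : BrokenH Ω cell J →L[ℝ] ℝ) (w : Fin N → FunGrad d) {c : Fin N → ℝ} (hcpos : ∀ i, 0 < c i) :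
    ∃ h ∈ brokenSobolev Ω cell S K, ∀ v, ∀ hv : v ∈ brokenSobolev Ω cell S K,
      (∑ i, c i * gradForm (cell i) h v) + massForm Ω h v =
        L ⟨v, brokenSobolev_mono Ω cell hS (empty_subset _) hv⟩ -
          ∑ i, massForm (cell i) (w i) v := by
  set V := brokenSobolev Ω cell S K with hV
  have hVJ : V ≤ brokenSobolev Ω cell J ∅ := brokenSobolev_mono Ω cell hS (empty_subset _)
  have : CompleteSpace V := completeSpace_brokenSobolev hpart _ _
  obtain ⟨c₀, ⟨hc₀, hc₁⟩, hc₀pos⟩ : ∃ c₀ : ℝ, ((∀ i, c₀ ≤ c i) ∧ c₀ ≤ 1) ∧ 0 < c₀ := by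
    refine Eventually.exists (f := 𝓝[>] (0 : ℝ)) ?_
    have hle : ∀ b : ℝ, 0 < b → ∀ᶠ x in 𝓝[>] (0 : ℝ), x ≤ b := fun b hb => by
      filter_upwards [Ioo_mem_nhdsGT hb] with x hx using hx.2.le
    exact ((eventually_all.2 fun i => hle _ (hcpos i)).and (hle 1 one_pos)).and
      self_mem_nhdsWithin
  let B : FunGrad d →L[ℝ] FunGrad d →L[ℝ] ℝ := (∑ i, c i • gradForm (cell i)) + massForm Ω
  have hB : ∀ p q, B p q = (∑ i, c i * gradForm (cell i) p q) + massForm Ω p q := by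
    intro p q
    simp [B]
  let BV : V →L[ℝ] V →L[ℝ] ℝ := B.bilinearComp V.subtypeL V.subtypeL
  have hBV : ∀ p q : V, BV p q = B p q := fun _ _ => rfl
  have hcoer : IsCoercive BV := by
    refine ⟨c₀, hc₀pos, fun v => ?_⟩
    rw [hBV, hB, mul_assoc, ← sq]
    have hn : ‖v‖ ^ 2 = (∑ i, gradForm (cell i) (v : FunGrad d) v) + massForm Ω (v : FunGrad d) v :=
      norm_sq_eq hpart v.2
    rw [hn, mul_add, Finset.mul_sum]
    refine add_le_add (Finset.sum_le_sum fun i _ => ?_) ?_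
    · exact mul_le_mul_of_nonneg_right (hc₀ i) (gradForm_self_nonneg _ _)
    · nlinarith [massForm_self_nonneg Ω (v : FunGrad d)]
  let incl : V →L[ℝ] BrokenH Ω cell J := V.subtypeL.codRestrict _ fun v => hVJ v.2
  let T : V →L[ℝ] ℝ := L.comp incl - (∑ i, massForm (cell i) (w i)).comp V.subtypeL
  have hT : ∀ v : V, T v = L ⟨v, hVJ v.2⟩ - ∑ i, massForm (cell i) (w i) v := by
    intro v
    have h2 : T v = L ⟨v, hVJ v.2⟩ - (∑ i, massForm (cell i) (w i)) (v : FunGrad d) := rfl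
    rw [h2, sum_apply]
  obtain ⟨h, hh⟩ := hcoer.exists_forall_eq T
  refine ⟨h, h.2, fun v hv => ?_⟩
  rw [← hB, ← hBV h ⟨v, hv⟩, hh, hT]

theorem ae_cutOff_fst_eq {A : Set (Eu d)} (hA : MeasurableSet A) (p : FunGrad d) :
    ∀ᵐ x, x ∈ A → (cutOff hA p).fst x = p.fst x := by
  filter_upwards [cutOff_fst hA p] with x hx hxi
  rw [hx, indicator_of_mem hxi]

theorem ae_cutOff_snd_eq {A : Set (Eu d)} (hA : MeasurableSet A) (p : FunGrad d) :
    ∀ᵐ x, x ∈ A → (cutOff hA p).snd x = p.snd x := by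
  filter_upwards [cutOff_snd hA p] with x hx hxi
  rw [hx, indicator_of_mem hxi]

/-- If the right-hand side does not see the functions living in `cell i`, then neither does the
solution: it is enough to test with its restriction to that cell. -/
theorem ae_snd_eq_zero_of_forall_weighted_eq (hpart : IsLipschitzPartition Ω cell) {c : Fin N → ℝ}
    {i : Fin N} (hci : 0 < c i) {h : FunGrad d} (hh : h ∈ brokenSobolev Ω cell S K)
    (he : (∑ j, c j * gradForm (cell j) h (cutOff (hpart.measurableSet_cell i) h)) +
      massForm Ω h (cutOff (hpart.measurableSet_cell i) h) = 0) :
    ∀ᵐ x, x ∈ cell i → h.snd x = 0 := by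
  have mc := fun i => hpart.measurableSet_cell i
  have hcut := cutOff_mem_cellSobolev hpart hh i
  have e3 : ∑ j, c j * gradForm (cell j) h (cutOff (mc i) h) =
      c i * gradForm (cell i) h (cutOff (mc i) h) := by
    refine Finset.sum_eq_single i (fun j _ hj => ?_) (by simp)
    rw [gradForm_eq_zero_right (mc j) (ae_eq_zero_of_ne hpart hj hcut.2.1), mul_zero]
  have e4 : gradForm (cell i) h (cutOff (mc i) h) = gradForm (cell i) h h :=
    gradForm_congr (mc i) (.of_forall fun _ _ => rfl) (ae_cutOff_snd_eq _ _)
  have e5 : massForm Ω h (cutOff (mc i) h) = massForm (cell i) h h := by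
    rw [massForm_of_cell hpart _ hcut.1]
    exact massForm_congr (mc i) (.of_forall fun _ _ => rfl) (ae_cutOff_fst_eq _ _)
  rw [e3, e4, e5] at he
  have n1 := massForm_self_nonneg (cell i) h
  have n2 := gradForm_self_nonneg (cell i) h
  exact ae_eq_zero_of_gradForm_self (mc i) (by nlinarith)

theorem notMem_inftySet_of_mem_zeroSet {l : Fin N → ℝ≥0∞} {i : Fin N} (hi : i ∈ zeroSet l) :
    i ∉ inftySet l := by
  intro hi'
  have h1 : l i = 0 := hi
  have h2 : l i = ⊤ := hi'
  rw [h1] at h2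
  exact ENNReal.zero_ne_top h2

theorem ContinuousLinearMap.map_add_sum₂ {H : Type*} [NormedAddCommGroup H] [NormedSpace ℝ H]
    (B : H →L[ℝ] H →L[ℝ] ℝ) {ι : Type*} (s : Finset ι) (h v : H) (w : ι → H) :
    B (h + ∑ i ∈ s, w i) v = B h v + ∑ i ∈ s, B (w i) v := by
  rw [map_add, map_sum, add_apply, sum_apply]

theorem ContinuousLinearMap.map_zero_apply {H : Type*} [NormedAddCommGroup H] [NormedSpace ℝ H]
    (B : H →L[ℝ] H →L[ℝ] ℝ) (v : H) : B 0 v = 0 := by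
  rw [map_zero]; rfl

/-- The weights `0` and `∞` are replaced by `1`, and the right-hand side is corrected by the known
representatives in the cells of zero weight. The solution of the corrected problem has no energy
in those cells and is completed there by the representatives. -/
theorem exists_isDegenerateGradient (hpart : IsLipschitzPartition Ω cell)
    (L : BrokenH Ω cell J →L[ℝ] ℝ) {l : Fin N → ℝ≥0∞} (hl : zeroSet l ⊆ J)
    (hrep : ∀ i ∈ zeroSet l, ∃ w ∈ cellSobolev cell i, RepresentsOnCell L i w) :
    ∃ g, IsDegenerateGradient L l g := by
  classical
  have hw : ∀ i, ∃ w : FunGrad d, (i ∈ zeroSet l → w ∈ cellSobolev cell i ∧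
      RepresentsOnCell L i w) ∧ (i ∉ zeroSet l → w = 0) := by
    intro i
    by_cases hi : i ∈ zeroSet l
    · obtain ⟨w, hw, hw'⟩ := hrep i hi
      exact ⟨w, fun _ => ⟨hw, hw'⟩, fun h => absurd hi h⟩
    · exact ⟨0, fun h => absurd h hi, fun _ => rfl⟩
  choose w hw hw0 using hw
  have hVJ : brokenSobolev Ω cell (zeroSet l) (inftySet l) ≤ brokenSobolev Ω cell J ∅ :=
    brokenSobolev_mono Ω cell hl (empty_subset _)
  have hcell : ∀ i ∈ zeroSet l, ∀ k ∈ cellSobolev cell i,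
      k ∈ brokenSobolev Ω cell (zeroSet l) (inftySet l) := fun i hi k hk =>
    cellSobolev_subset hpart hi (notMem_inftySet_of_mem_zeroSet hi) hk
  have hwV : ∀ i, w i ∈ brokenSobolev Ω cell (zeroSet l) (inftySet l) := fun i => by
    by_cases hi : i ∈ zeroSet l
    · exact hcell i hi _ (hw i hi).1
    · rw [hw0 i hi]; exact Submodule.zero_mem _
  let c : Fin N → ℝ := fun i => if l i = 0 ∨ l i = ⊤ then 1 else (l i).toReal
  have hcpos : ∀ i, 0 < c i := fun i => by
    simp only [c]
    split_ifs with h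
    · exact one_pos
    · push Not at h
      exact ENNReal.toReal_pos h.1 h.2
  obtain ⟨h, hhV, hh⟩ := exists_forall_weighted_eq (K := inftySet l) hpart hl L w hcpos
  have mc := fun i => hpart.measurableSet_cell i
  -- On functions living in a cell of zero weight the corrected right-hand side vanishes.
  have hh0 : ∀ i ∈ zeroSet l, ∀ᵐ x, x ∈ cell i → h.snd x = 0 := by
    intro i hi
    have hcut := cutOff_mem_cellSobolev hpart hhV i
    refine ae_snd_eq_zero_of_forall_weighted_eq hpart (hcpos i) hhV ?_
    rw [hh _ (hcell i hi _ hcut), (hw i hi).2 ⟨_, hVJ (hcell i hi _ hcut)⟩ hcut.1,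
      ← massForm_apply, sub_eq_zero, eq_comm]
    refine Finset.sum_eq_single i (fun j _ hj => ?_) (by simp)
    rw [massForm_comm]
    exact massForm_eq_zero_left (mc j) (ae_eq_zero_of_ne hpart hj hcut.1) _
  have hgV : h + ∑ i, w i ∈ brokenSobolev Ω cell (zeroSet l) (inftySet l) :=
    Submodule.add_mem _ hhV (Submodule.sum_mem _ fun i _ => hwV i)
  suffices H : ∀ v, ∀ hv : v ∈ brokenSobolev Ω cell (zeroSet l) (inftySet l),
      weightedForm Ω cell l (h + ∑ i, w i) v = L ⟨v, hVJ hv⟩ from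
    ⟨⟨h + ∑ i, w i, hVJ hgV⟩, hgV, fun v hv => H v hv⟩
  intro v hv
  have e := hh v hv
  have e1 : ∀ i, (l i).toReal * gradForm (cell i) (h + ∑ j, w j) v =
      c i * gradForm (cell i) h v := by
    intro i
    by_cases hi : l i = 0
    · rw [hi, ENNReal.toReal_zero, zero_mul, gradForm_eq_zero_left (mc i) (hh0 i hi), mul_zero]
    -- Both sides vanish where the weight is infinite, as `v` is constant there.
    by_cases hi' : l i = ⊤
    · rw [gradForm_eq_zero_right (mc i) (ae_snd_eq_zero_of_mem hpart hv hi'),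
        gradForm_eq_zero_right (mc i) (ae_snd_eq_zero_of_mem hpart hv hi'), mul_zero, mul_zero]
    have hci : c i = (l i).toReal := by simp [c, hi, hi']
    rw [hci, ContinuousLinearMap.map_add_sum₂, Finset.sum_eq_zero, add_zero]
    intro j _
    by_cases hj : j ∈ zeroSet l
    · have hij : i ≠ j := fun h => hi (h ▸ hj)
      exact gradForm_eq_zero_left (mc i) (ae_eq_zero_of_ne hpart hij (hw j hj).1.2.1) _
    · rw [hw0 j hj, ContinuousLinearMap.map_zero_apply]
  have e2 : massForm Ω (h + ∑ j, w j) v =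
      massForm Ω h v + ∑ i, massForm (cell i) (w i) v := by
    rw [ContinuousLinearMap.map_add_sum₂]
    congr 1
    refine Finset.sum_congr rfl fun i _ => ?_
    by_cases hi : i ∈ zeroSet l
    · rw [massForm_comm, massForm_of_cell hpart _ (hw i hi).1.1, massForm_comm]
    · rw [hw0 i hi, ContinuousLinearMap.map_zero_apply, ContinuousLinearMap.map_zero_apply]
  rw [weightedForm_eq, e2, Finset.sum_congr rfl fun i _ => e1 i, ← add_assoc, e, sub_add_cancel]

end DegenerateGradient

/-! ### Limits of degenerate gradients -/

section Limit

open IsLipschitzPartition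

/-- Weak compactness of bounded sets in Hilbert spaces, along ultrafilters. -/
theorem Ultrafilter.exists_weak_limit {H : Type*} [NormedAddCommGroup H] [InnerProductSpace ℝ H]
    [CompleteSpace H] {ι : Type*} (𝓤 : Ultrafilter ι) (g : ι → H) {R : ℝ}
    (hR : ∀ᶠ n in 𝓤, ‖g n‖ ≤ R) :
    ∃ g₀, ∀ T : H →L[ℝ] ℝ, Tendsto (fun n => T (g n)) 𝓤 (𝓝 (T g₀)) := by
  have hc : IsCompact (WeakDual.toStrongDual ⁻¹' Metric.closedBall (0 : StrongDual ℝ H) R) :=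
    WeakDual.isCompact_closedBall 0 R
  let x : ι → WeakDual ℝ H := fun n =>
    StrongDual.toWeakDual (InnerProductSpace.toDual ℝ H (g n))
  obtain ⟨x₀, -, hx₀⟩ := hc.ultrafilter_le_nhds (𝓤.map x) (by
    rw [le_principal_iff]
    change ∀ᶠ n in (𝓤 : Filter ι), x n ∈ _
    filter_upwards [hR] with n hn
    change InnerProductSpace.toDual ℝ H (g n) ∈ Metric.closedBall (0 : StrongDual ℝ H) R
    rw [mem_closedBall_zero_iff, LinearIsometryEquiv.norm_map]
    exact hn)
  refine ⟨(InnerProductSpace.toDual ℝ H).symm (WeakDual.toStrongDual x₀), fun T => ?_⟩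
  have h1 := (((WeakDual.eval_continuous ((InnerProductSpace.toDual ℝ H).symm T)).tendsto x₀).mono_left
    hx₀)
  have h2 : Tendsto (fun n => x n ((InnerProductSpace.toDual ℝ H).symm T)) 𝓤
      (𝓝 (x₀ ((InnerProductSpace.toDual ℝ H).symm T))) := h1
  have e1 : ∀ n, x n ((InnerProductSpace.toDual ℝ H).symm T) = T (g n) := fun n => by
    change ⟪g n, (InnerProductSpace.toDual ℝ H).symm T⟫_ℝ = _
    rw [real_inner_comm, InnerProductSpace.toDual_symm_apply]
  have e2 : x₀ ((InnerProductSpace.toDual ℝ H).symm T) =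
      T ((InnerProductSpace.toDual ℝ H).symm (WeakDual.toStrongDual x₀)) := by
    rw [← InnerProductSpace.toDual_symm_apply (y := T), real_inner_comm,
      InnerProductSpace.toDual_symm_apply]
    rfl
  simp only [e1, e2] at h2
  exact h2

variable {d N : ℕ} {Ω : Set (Eu d)} {cell : Fin N → Set (Eu d)} {S K J : Set (Fin N)}

/-- The extension theorem in the form in which it is used: each element of `V_{S,K}` agrees off the
closures of the cells of `S` with a function without jumps. -/
theorem exists_extension_of_mem (hpart : IsLipschitzPartition Ω cell) (hSK : Disjoint S K)
    {v : FunGrad d} (hv : v ∈ brokenSobolev Ω cell S K) :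
    ∃ p ∈ brokenSobolev Ω cell ∅ K, ∀ᵐ x, x ∈ awayFrom cell Sᶜ → p.fst x = v.fst x := by
  set F : Set (Eu d) := ⋃ j ∈ S, closure (cell j) with hF
  have hUL := hpart.union_lipschitz S
  rw [← hF] at hUL
  set U := interior F with hU
  have hFc : IsClosed F := S.toFinite.isClosed_biUnion fun _ _ => isClosed_closure
  have hcl : closure U = F := by
    refine Subset.antisymm (closure_minimal interior_subset hFc) (iUnion₂_subset fun j hj => ?_)
    refine closure_mono (interior_maximal ?_ (hpart.isOpen_cell j))
    exact subset_closure.trans (subset_biUnion_of_mem (u := fun j => closure (cell j)) hj)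
  have hFΩ : F ⊆ closure Ω := iUnion₂_subset fun j _ => closure_mono (hpart.cell_subset j)
  have hE : (closure U)ᶜ = awayFrom cell Sᶜ := by
    rw [hcl, awayFrom, compl_compl]
  have hUb : Bornology.IsBounded U := hpart.bounded.closure.subset (interior_subset.trans hFΩ)
  have hvE : IsH1On (closure U)ᶜ v.fst v.snd := by
    rw [hE]; exact FunGrad.isH1On hv.2.2.1
  obtain ⟨w, G, hw, hwv⟩ := hUL.exists_extension hUb hvE
  -- The extension is prescribed off `closure U`, and `closure U \ Ω` is contained in the null set
  -- `frontier Ω`.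
  have hbd : ∀ᵐ x, x ∉ frontier Ω :=
    measure_eq_zero_iff_ae_notMem.1 hpart.lipschitz.volume_frontier
  have hw0 : ∀ᵐ x, x ∉ Ω → w x = 0 := by
    filter_upwards [hwv, hv.1, hbd] with x h1 h2 h3 hx
    by_cases hxF : x ∈ closure U
    · refine absurd ?_ h3
      rw [hpart.lipschitz.1.frontier_eq]
      exact ⟨hFΩ (hcl ▸ hxF), hx⟩
    · rw [h1 hxF, h2 hx]
  have hG0 : ∀ᵐ x, x ∉ ⋃ i, cell i → G x = 0 := by
    have hext : ∀ᵐ x, x ∈ (closure Ω)ᶜ → G x = 0 := by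
      refine (hw.weakGrad.mono (subset_univ _)).ae_eq_zero isClosed_closure.isOpen_compl
        hw.memLp_grad (c := 0) ?_
      filter_upwards [hw0] with x hx hxΩ using hx fun h => hxΩ (subset_closure h)
    filter_upwards [hext, hbd, hpart.ae_mem_cell] with x h1 h2 h3 hx
    by_cases hxΩ : x ∈ Ω
    · exact absurd (mem_iUnion.2 (h3 hxΩ)) hx
    · refine h1 fun hxc => h2 ?_
      rw [hpart.lipschitz.1.frontier_eq]
      exact ⟨hxc, hxΩ⟩
  let p : FunGrad d := WithLp.toLp 2 (hw.memLp.toLp w, hw.memLp_grad.toLp G)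
  have p1 : ∀ᵐ x, p.fst x = w x := hw.memLp.coeFn_toLp
  have p2 : ∀ᵐ x, p.snd x = G x := hw.memLp_grad.coeFn_toLp
  have hpu : IsWeakGradOn univ p.fst p.snd := hw.weakGrad.congr
    (by filter_upwards [p1] with x hx _ using hx.symm)
    (by filter_upwards [p2] with x hx _ using hx.symm)
  have hpv : ∀ᵐ x, x ∈ awayFrom cell Sᶜ → p.fst x = v.fst x := by
    rw [← hE]
    filter_upwards [p1, hwv] with x h1 h2 hx
    rw [h1, h2 hx]
  refine ⟨p, ⟨?_, ?_, hpu.mono (subset_univ _), fun i _ => hpu.mono (subset_univ _), ?_⟩, hpv⟩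
  · filter_upwards [p1, hw0] with x h1 h2 hx
    rw [h1, h2 hx]
  · filter_upwards [p2, hG0] with x h1 h2 hx
    rw [h1, h2 hx]
  · intro i hi
    obtain ⟨C, hC⟩ := hv.2.2.2.2 i hi
    refine ⟨C, ?_⟩
    have hiS : i ∈ Sᶜ := fun h => disjoint_left.1 hSK h hi
    filter_upwards [hC, hpv] with x h1 h2 hx
    rw [h2 (hpart.cell_subset_awayFrom hiS hx), h1 hx]

/-- The gradient of an element of `𝓗` that is a test function in one cell. -/
theorem ae_snd_eq_gradient (hpart : IsLipschitzPartition Ω cell) {v : FunGrad d}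
    (hv : v ∈ brokenSobolev Ω cell S K) {i : Fin N} {φ : Eu d → ℝ} (h1 : ContDiff ℝ ∞ φ)
    (h2 : HasCompactSupport φ) (h3 : tsupport φ ⊆ cell i) (hφ : v.fst =ᵐ[volume] φ) :
    ∀ᵐ x, v.snd x = gradient φ x := by
  have hg0 : ∀ x ∉ cell i, gradient φ x = 0 := fun x hx => by
    have : φ =ᶠ[𝓝 x] fun _ => 0 := notMem_tsupport_iff_eventuallyEq.1 fun h => hx (h3 h)
    rw [this.gradient_eq, gradient_fun_const]
  have hg : MemLp (gradient φ) 2 := by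
    have hc : HasCompactSupport (gradient φ) := by
      have := (h2.fderiv ℝ)
      exact this.comp_left (g := (InnerProductSpace.toDual ℝ (Eu d)).symm) (map_zero _)
    exact h1.continuous_gradient.memLp_of_hasCompactSupport hc
  have hcell : ∀ j, ∀ᵐ x, x ∈ cell j → v.snd x = gradient φ x := fun j => by
    refine (isWeakGradOn_cell hpart hv j).unique (hpart.isOpen_cell j) ?_ (Lp.memLp _) hg
    refine ((h1.isWeakGradOn_gradient h2).mono (subset_univ _)).congr ?_ (.of_forall fun _ _ => rfl)
    filter_upwards [hφ] with x hx _ using hx.symm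
  filter_upwards [ae_all_iff.2 hcell, hv.2.1] with x h4 h5
  by_cases hx : x ∈ ⋃ j, cell j
  · obtain ⟨j, hj⟩ := mem_iUnion.1 hx
    exact h4 j hj
  · rw [h5 hx, hg0 x fun h => hx (mem_iUnion.2 ⟨i, h⟩)]

/-- A test function in one cell belongs to all the spaces that do not force it to be constant
there. -/
theorem mem_brokenSobolev_of_test (hpart : IsLipschitzPartition Ω cell) {v : FunGrad d}
    (hv : v ∈ brokenSobolev Ω cell J ∅) {i : Fin N} {φ : Eu d → ℝ} (h1 : ContDiff ℝ ∞ φ)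
    (h2 : HasCompactSupport φ) (h3 : tsupport φ ⊆ cell i) (hφ : v.fst =ᵐ[volume] φ)
    (hK : i ∉ K) : v ∈ brokenSobolev Ω cell S K := by
  have hw : IsWeakGradOn univ v.fst v.snd := (h1.isWeakGradOn_gradient h2).congr
    (by filter_upwards [hφ] with x hx _ using hx.symm)
    (by filter_upwards [ae_snd_eq_gradient hpart hv h1 h2 h3 hφ] with x hx _ using hx.symm)
  refine ⟨hv.1, hv.2.1, hw.mono (subset_univ _), fun _ _ => hw.mono (subset_univ _),
    fun k hk => ⟨0, ?_⟩⟩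
  filter_upwards [hφ] with x hx hxk
  have hik : i ≠ k := fun h => hK (h ▸ hk)
  rw [hx]
  refine image_eq_zero_of_notMem_tsupport fun h => ?_
  exact disjoint_left.1 (hpart.cell_disjoint i k hik) (h3 h) hxk

/-- Closed subspaces are weakly closed. -/
theorem Submodule.mem_of_weak_limit {H : Type*} [NormedAddCommGroup H] [InnerProductSpace ℝ H]
    (V : Submodule ℝ H) [CompleteSpace V] {ι : Type*} {l : Filter ι} [l.NeBot] {g : ι → H} {g₀ : H}
    (hg : ∀ᶠ n in l, g n ∈ V)
    (h : ∀ q : H, Tendsto (fun n => ⟪q, g n⟫_ℝ) l (𝓝 ⟪q, g₀⟫_ℝ)) : g₀ ∈ V := by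
  rw [← V.orthogonal_orthogonal, Submodule.mem_orthogonal]
  intro q hq
  refine tendsto_nhds_unique (h q) (tendsto_const_nhds.congr' ?_)
  filter_upwards [hg] with n hn
  exact (Submodule.inner_left_of_mem_orthogonal hn hq).symm

section

variable {L : BrokenH Ω cell J →L[ℝ] ℝ} {ι : Type*} {𝓤 : Filter ι} {ℓ : ι → Fin N → ℝ≥0∞}
  {g : ι → BrokenH Ω cell J} {l : Fin N → ℝ≥0∞} {g₀ : BrokenH Ω cell J}

theorem tendsto_of_weak (hweak : ∀ T : BrokenH Ω cell J →L[ℝ] ℝ,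
    Tendsto (fun n => T (g n)) 𝓤 (𝓝 (T g₀))) (T : FunGrad d →L[ℝ] ℝ) :
    Tendsto (fun n => T (g n)) 𝓤 (𝓝 (T g₀)) :=
  hweak (T.comp (brokenSobolev Ω cell J ∅).subtypeL)

theorem eventually_zeroSet_subset (hl : Tendsto ℓ 𝓤 (𝓝 l)) :
    ∀ᶠ n in 𝓤, zeroSet (ℓ n) ⊆ zeroSet l := by
  have : ∀ i, ∀ᶠ n in 𝓤, ℓ n i = 0 → l i = 0 := fun i => by
    by_cases h : l i = 0
    · exact .of_forall fun _ _ => h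
    · filter_upwards [((tendsto_pi_nhds.1 hl) i).eventually_ne h] with n hn h0 using absurd h0 hn
  filter_upwards [eventually_all.2 this] with n hn i hi using hn i hi

theorem eventually_inftySet_subset (hl : Tendsto ℓ 𝓤 (𝓝 l)) :
    ∀ᶠ n in 𝓤, inftySet (ℓ n) ⊆ inftySet l := by
  have : ∀ i, ∀ᶠ n in 𝓤, ℓ n i = ⊤ → l i = ⊤ := fun i => by
    by_cases h : l i = ⊤
    · exact .of_forall fun _ _ => h
    · filter_upwards [((tendsto_pi_nhds.1 hl) i).eventually_ne h] with n hn h0 using absurd h0 hn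
  filter_upwards [eventually_all.2 this] with n hn i hi using hn i hi

/-- The equation passes to the limit for test functions that are admissible for the approximating
weights and have no gradient in the cells of infinite limit weight. -/
theorem weightedForm_limit [𝓤.NeBot] (hpart : IsLipschitzPartition Ω cell)
    (hg : ∀ n, IsDegenerateGradient L (ℓ n) (g n)) (hl : Tendsto ℓ 𝓤 (𝓝 l))
    (hweak : ∀ T : BrokenH Ω cell J →L[ℝ] ℝ, Tendsto (fun n => T (g n)) 𝓤 (𝓝 (T g₀)))
    {v : BrokenH Ω cell J}
    (hv : ∀ᶠ n in 𝓤, (v : FunGrad d) ∈ brokenSobolev Ω cell (zeroSet (ℓ n)) (inftySet (ℓ n)))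
    (hv0 : ∀ i, l i = ⊤ → ∀ᵐ x, x ∈ cell i → (v : FunGrad d).snd x = 0) :
    weightedForm Ω cell l g₀ v = L v := by
  have hlim : Tendsto (fun n => weightedForm Ω cell (ℓ n) (g n) v) 𝓤
      (𝓝 (weightedForm Ω cell l g₀ v)) := by
    simp only [weightedForm_eq]
    refine Tendsto.add (tendsto_finsetSum _ fun i _ => ?_)
      (tendsto_of_weak hweak ((massForm Ω).flip v))
    by_cases hi : l i = ⊤
    · have h0 : ∀ p : FunGrad d, gradForm (cell i) p v = 0 :=
        gradForm_eq_zero_right (hpart.measurableSet_cell i) (hv0 i hi)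
      simp only [h0, mul_zero]
      exact tendsto_const_nhds
    · exact ((ENNReal.tendsto_toReal hi).comp ((tendsto_pi_nhds.1 hl) i)).mul
        (tendsto_of_weak hweak ((gradForm (cell i)).flip v))
  refine tendsto_nhds_unique hlim (tendsto_const_nhds.congr' ?_)
  filter_upwards [hv] with n hn using ((hg n).2 v hn).symm

/-- In a cell whose weights tend to infinity the energies tend to zero, because the weighted
energies stay bounded. -/
theorem ae_snd_eq_zero_of_limit_top [𝓤.NeBot] (hpart : IsLipschitzPartition Ω cell)
    (hg : ∀ n, IsDegenerateGradient L (ℓ n) (g n)) (hl : Tendsto ℓ 𝓤 (𝓝 l))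
    {R : ℝ} (hR : ∀ᶠ n in 𝓤, ‖g n‖ ≤ R)
    (hweak : ∀ T : BrokenH Ω cell J →L[ℝ] ℝ, Tendsto (fun n => T (g n)) 𝓤 (𝓝 (T g₀)))
    {i : Fin N} (hi : l i = ⊤) : ∀ᵐ x, x ∈ cell i → (g₀ : FunGrad d).snd x = 0 := by
  refine ae_eq_zero_of_gradForm_self (hpart.measurableSet_cell i) ?_
  set a := gradForm (cell i) (g₀ : FunGrad d) g₀ with ha
  set C := ‖L‖ * R with hC
  have ha0 : 0 ≤ a := gradForm_self_nonneg _ _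
  have hen : ∀ᶠ n in 𝓤, (ℓ n i).toReal * gradForm (cell i) (g n : FunGrad d) (g n) ≤ C := by
    filter_upwards [hR] with n hn
    have e := (hg n).2 (g n) (hg n).1
    rw [weightedForm_eq] at e
    have h1 : (ℓ n i).toReal * gradForm (cell i) (g n : FunGrad d) (g n) ≤
        ∑ j, (ℓ n j).toReal * gradForm (cell j) (g n : FunGrad d) (g n) :=
      Finset.single_le_sum (f := fun j => (ℓ n j).toReal * gradForm (cell j) (g n : FunGrad d) (g n))
        (fun j _ => mul_nonneg ENNReal.toReal_nonneg (gradForm_self_nonneg _ _))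
        (Finset.mem_univ i)
    have h2 := massForm_self_nonneg Ω (g n : FunGrad d)
    have h3 : L (g n) ≤ C := (le_abs_self _).trans ((L.le_opNorm _).trans
      (mul_le_mul_of_nonneg_left hn L.opNorm_nonneg))
    linarith
  have hC0 : 0 ≤ C := by
    obtain ⟨n, hn⟩ := hen.exists
    exact (mul_nonneg ENNReal.toReal_nonneg (gradForm_self_nonneg _ _)).trans hn
  -- Eventually `k ≤ λⁿ i`, so that `k` times the energy of `gⁿ` is at most `C`; this carries over
  -- to the weak limit by the Cauchy–Schwarz inequality, for all `k`.
  have key : ∀ k : ℝ, 0 < k → k * a ^ 2 ≤ C * a := by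
    intro k hk
    have hlim : Tendsto (fun n => k * gradForm (cell i) (g n : FunGrad d) g₀ ^ 2) 𝓤
        (𝓝 (k * a ^ 2)) :=
      ((tendsto_of_weak hweak ((gradForm (cell i)).flip g₀)).pow 2).const_mul k
    refine le_of_tendsto hlim ?_
    have hbig : ∀ᶠ n in 𝓤, ENNReal.ofReal k < ℓ n i :=
      ((tendsto_pi_nhds.1 hl) i).eventually_const_lt (by rw [hi]; exact ENNReal.ofReal_lt_top)
    filter_upwards [hen, hbig] with n h1 h2
    have h3 : k * gradForm (cell i) (g n : FunGrad d) (g n) ≤ C := by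
      -- A weight that is already infinite has `toReal` equal to zero: there `gⁿ` is constant.
      by_cases htop : ℓ n i = ⊤
      · rw [gradForm_eq_zero_left (hpart.measurableSet_cell i)
          (ae_snd_eq_zero_of_mem hpart (hg n).1 htop), mul_zero]
        exact hC0
      · refine le_trans (mul_le_mul_of_nonneg_right ?_ (gradForm_self_nonneg _ _)) h1
        exact (ENNReal.ofReal_le_iff_le_toReal htop).1 h2.le
    calc k * gradForm (cell i) (g n : FunGrad d) g₀ ^ 2
        ≤ k * (gradForm (cell i) (g n : FunGrad d) (g n) * a) :=
          mul_le_mul_of_nonneg_left (sq_gradForm_le _ _ _) hk.le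
      _ = (k * gradForm (cell i) (g n : FunGrad d) (g n)) * a := by ring
      _ ≤ C * a := mul_le_mul_of_nonneg_right h3 ha0
  by_contra hne
  have hapos : 0 < a := lt_of_le_of_ne ha0 (Ne.symm hne)
  have h1 := key ((C + 1) / a) (by positivity)
  have h2 : (C + 1) / a * a ^ 2 = (C + 1) * a := by field_simp
  rw [h2] at h1
  nlinarith

/-- If the equation holds against the functions living in the single cells of `F`, then it holds
against the functions living in their union. -/
theorem weightedForm_eq_of_cells (hpart : IsLipschitzPartition Ω cell) {F : Finset (Fin N)}
    (hF : (F : Set (Fin N)) ⊆ J)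
    (hcell : ∀ i ∈ F, ∀ y : BrokenH Ω cell J, (y : FunGrad d) ∈ cellSobolev cell i →
      weightedForm Ω cell l g₀ y = L y) :
    ∀ z : BrokenH Ω cell J,
      (∀ᵐ x, x ∈ Ω → (∀ i ∈ F, x ∉ cell i) → (z : FunGrad d).fst x = 0) →
      weightedForm Ω cell l g₀ z = L z := by
  classical
  induction F using Finset.induction_on with
  | empty =>
    intro z hz
    have h0 : (z : FunGrad d) = 0 := eq_zero_of_ae_fst_eq_zero hpart z.2 (by
      filter_upwards [hz] with x hx hxΩ using hx hxΩ (by simp))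
    have h1 : z = 0 := by exact_mod_cast h0
    rw [h1, map_zero, weightedForm_eq]
    simp
  | insert i F hi ih =>
    intro z hz
    have hcut := cutOff_mem_cellSobolev hpart z.2 i
    have hy : cutOff (hpart.measurableSet_cell i) (z : FunGrad d) ∈ brokenSobolev Ω cell J ∅ :=
      cellSobolev_subset hpart (hF (by simp)) (notMem_empty i) hcut
    set y : BrokenH Ω cell J := ⟨_, hy⟩ with hydef
    have e1 := hcell i (by simp) y hcut
    have e2 := ih (fun j hj => hF (by simp [Finset.mem_coe.1 hj]))
      (fun j hj => hcell j (Finset.mem_insert_of_mem hj)) (z - y) (by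
        have hc : ((z - y : BrokenH Ω cell J) : FunGrad d).fst =
          (z : FunGrad d).fst - (y : FunGrad d).fst := rfl
        rw [hc]
        filter_upwards [Lp.coeFn_sub (z : FunGrad d).fst (y : FunGrad d).fst, hz,
          cutOff_fst (hpart.measurableSet_cell i) (z : FunGrad d)] with x h1 h2 h3 hxΩ hxF
        have h3' : (y : FunGrad d).fst x = (cell i).indicator (z : FunGrad d).fst x := h3
        rw [h1, Pi.sub_apply, h3']
        by_cases hxi : x ∈ cell i
        · rw [indicator_of_mem hxi, sub_self]
        · rw [indicator_of_notMem hxi, sub_zero]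
          refine h2 hxΩ fun j hj => ?_
          rcases Finset.mem_insert.1 hj with h | h
          · exact h ▸ hxi
          · exact hxF j h)
    have e3 : weightedForm Ω cell l g₀ (z - y : BrokenH Ω cell J) =
        weightedForm Ω cell l g₀ z - weightedForm Ω cell l g₀ y := by
      simp only [weightedForm_eq, Submodule.coe_sub, map_sub, mul_sub, Finset.sum_sub_distrib]
      ring
    rw [e3, e1, map_sub] at e2
    linarith

/-- The weak limit of degenerate gradients `g(λⁿ)` is the degenerate gradient of the limit weight,
provided that the cells in which `L` is represented by an `H¹` function are exactly those of `J`.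
In particular no new weight zero appears outside `J`. -/
theorem isDegenerateGradient_of_limit [𝓤.NeBot] (hpart : IsLipschitzPartition Ω cell)
    (hJ : J = h1Cells L)
    (hg₀ : ∀ i ∈ J, ∀ w ∈ cellSobolev cell i,
      RepresentsInDistributions L i w → RepresentsOnCell L i w)
    (hg : ∀ n, IsDegenerateGradient L (ℓ n) (g n)) (hl : Tendsto ℓ 𝓤 (𝓝 l))
    {R : ℝ} (hR : ∀ᶠ n in 𝓤, ‖g n‖ ≤ R)
    (hweak : ∀ T : BrokenH Ω cell J →L[ℝ] ℝ, Tendsto (fun n => T (g n)) 𝓤 (𝓝 (T g₀))) :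
    zeroSet l ⊆ J ∧ IsDegenerateGradient L l g₀ := by
  classical
  have mc := fun i => hpart.measurableSet_cell i
  have hmem0 : (g₀ : FunGrad d) ∈ brokenSobolev Ω cell (zeroSet l) ∅ := by
    have : CompleteSpace (brokenSobolev Ω cell (zeroSet l) ∅) :=
      completeSpace_brokenSobolev hpart _ _
    refine Submodule.mem_of_weak_limit (l := 𝓤) (g := fun n => (g n : FunGrad d)) _ ?_
      fun q => tendsto_of_weak hweak (innerSL ℝ q)
    filter_upwards [eventually_zeroSet_subset hl] with n hn
    exact brokenSobolev_mono Ω cell hn (empty_subset _) (hg n).1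
  have hmem : (g₀ : FunGrad d) ∈ brokenSobolev Ω cell (zeroSet l) (inftySet l) := by
    refine ⟨hmem0.1, hmem0.2.1, hmem0.2.2.1, hmem0.2.2.2.1, fun i hi => ?_⟩
    have h0 := ae_snd_eq_zero_of_limit_top hpart hg hl hR hweak hi
    refine IsH1On.ae_eq_const (hpart.isOpen_cell i) (hpart.cell_connected i)
      ⟨Lp.memLp _, MemLp.zero, (isWeakGradOn_cell hpart hmem0 i).congr
        (.of_forall fun _ _ => rfl) ?_⟩
    exact h0
  -- In the cells of zero weight the equation reduces to the representation of `L` by `g₀`.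
  have hrep : ∀ i ∈ zeroSet l,
      RepresentsInDistributions L i (cutOff (mc i) (g₀ : FunGrad d)) := by
    rintro i hi v ⟨φ, h1, h2, h3, h4⟩
    have hiK : i ∉ inftySet l := notMem_inftySet_of_mem_zeroSet hi
    have hgr := ae_snd_eq_gradient hpart v.2 h1 h2 h3 h4
    have hfst : ∀ᵐ x, x ∉ cell i → (v : FunGrad d).fst x = 0 := by
      filter_upwards [h4] with x hx hxi
      rw [hx]
      exact image_eq_zero_of_notMem_tsupport fun h => hxi (h3 h)
    have hsnd : ∀ᵐ x, x ∉ cell i → (v : FunGrad d).snd x = 0 := by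
      filter_upwards [hgr] with x hx hxi
      have : φ =ᶠ[𝓝 x] fun _ => 0 := notMem_tsupport_iff_eventuallyEq.1 fun h => hxi (h3 h)
      rw [hx, this.gradient_eq, gradient_fun_const]
    have e := weightedForm_limit hpart hg hl hweak (v := v)
      (by
        filter_upwards [eventually_inftySet_subset hl] with n hn
        exact mem_brokenSobolev_of_test hpart v.2 h1 h2 h3 h4 fun h => hiK (hn h))
      (fun j hj => ae_eq_zero_of_ne hpart (fun h : j = i => hiK (h ▸ hj)) hsnd)
    rw [← e, weightedForm_of_cell hpart hi _ hfst hsnd, ← massForm_apply]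
    refine massForm_congr (mc i) ?_ (.of_forall fun _ _ => rfl)
    filter_upwards [ae_cutOff_fst_eq (mc i) (g₀ : FunGrad d)] with x hx hxi using (hx hxi).symm
  have hzJ : zeroSet l ⊆ J := fun i hi => by
    rw [hJ]
    exact ⟨_, cutOff_mem_cellSobolev hpart g₀.2 i, hrep i hi⟩
  have hcell : ∀ i ∈ zeroSet l, ∀ y : BrokenH Ω cell J, (y : FunGrad d) ∈ cellSobolev cell i →
      weightedForm Ω cell l g₀ y = L y := by
    intro i hi y hy
    rw [weightedForm_of_cell hpart hi _ hy.1 hy.2.1,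
      hg₀ i (hzJ hi) _ (cutOff_mem_cellSobolev hpart g₀.2 i) (hrep i hi) y hy.1, ← massForm_apply]
    refine massForm_congr (mc i) ?_ (.of_forall fun _ _ => rfl)
    filter_upwards [ae_cutOff_fst_eq (mc i) (g₀ : FunGrad d)] with x hx hxi using (hx hxi).symm
  refine ⟨hzJ, hmem, fun v hv => ?_⟩
  have hdisj : Disjoint (zeroSet l) (inftySet l) :=
    disjoint_left.2 fun i hi => notMem_inftySet_of_mem_zeroSet hi
  -- The extension is admissible for all the approximating weights, unlike `v` itself.
  obtain ⟨p, hp, hpv⟩ := exists_extension_of_mem hpart hdisj hv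
  have hpJ : p ∈ brokenSobolev Ω cell J ∅ :=
    brokenSobolev_mono Ω cell (empty_subset _) (empty_subset _) hp
  have e1 := weightedForm_limit hpart hg hl hweak (v := ⟨p, hpJ⟩)
    (by
      filter_upwards [eventually_inftySet_subset hl] with n hn
      exact brokenSobolev_mono Ω cell (empty_subset _) hn hp)
    (fun j hj => ae_snd_eq_zero_of_mem hpart hp hj)
  have e2 := weightedForm_eq_of_cells (F := (zeroSet l).toFinset) (l := l) (g₀ := g₀) (L := L) hpart
    (by simpa using hzJ) (fun i hi => hcell i (by simpa using hi)) (v - ⟨p, hpJ⟩) (by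
      have hc : ((v - ⟨p, hpJ⟩ : BrokenH Ω cell J) : FunGrad d).fst =
        (v : FunGrad d).fst - p.fst := rfl
      rw [hc]
      filter_upwards [Lp.coeFn_sub (v : FunGrad d).fst p.fst, hpv, hpart.ae_mem_cell] with
        x h1 h2 h3 hxΩ hxF
      obtain ⟨j, hj⟩ := h3 hxΩ
      have hjS : j ∈ (zeroSet l)ᶜ := fun h => hxF j (by simpa using h) hj
      rw [h1, Pi.sub_apply, h2 (hpart.cell_subset_awayFrom hjS hj), sub_self])
  have e3 : weightedForm Ω cell l g₀ (v - ⟨p, hpJ⟩ : BrokenH Ω cell J) =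
      weightedForm Ω cell l g₀ v - weightedForm Ω cell l g₀ p := by
    simp only [weightedForm_eq, Submodule.coe_sub, map_sub, mul_sub, Finset.sum_sub_distrib]
    ring
  rw [e3, map_sub] at e2
  change weightedForm Ω cell l g₀ p = L ⟨p, hpJ⟩ at e1
  linarith

end

end Limit

/-! ### The minimization problem -/

section Minimization

variable {d N : ℕ} {Ω : Set (Eu d)} {cell : Fin N → Set (Eu d)} {J : Set (Fin N)}

theorem top_mem_boundaryWeights (hpart : IsLipschitzPartition Ω cell) (J : Set (Fin N)) :
    (fun _ => ⊤) ∈ boundaryWeights (N := N) J := by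
  have hne : Nonempty (Fin N) := by
    by_contra hN
    rw [not_nonempty_iff] at hN
    have h0 : volume Ω = 0 := by simpa using hpart.cover
    exact (hpart.lipschitz.1.measure_pos volume hpart.nonempty).ne' h0
  obtain ⟨i⟩ := hne
  have hpos : posWeights N = Set.pi univ fun _ => Ioo (0 : ℝ≥0∞) ⊤ := by
    ext l
    simp [posWeights, Set.mem_pi]
  refine ⟨⟨?_, fun h => ?_⟩, fun j hj => ?_⟩
  · rw [hpos, closure_pi_set]
    intro j _
    rw [closure_Ioo ENNReal.zero_ne_top]
    exact ⟨zero_le, le_rfl⟩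
  · exact lt_irrefl _ ((interior_subset h : _ ∈ posWeights N) i).2
  · exact absurd (show (⊤ : ℝ≥0∞) = 0 from hj) ENNReal.top_ne_zero

/-- Sublevel sets of coercive quadratic functionals are bounded. -/
theorem exists_norm_le_of_quadratic_le {H : Type*} [NormedAddCommGroup H] [NormedSpace ℝ H]
    {Q : H →L[ℝ] H →L[ℝ] ℝ} (L : H →L[ℝ] ℝ) {m κ : ℝ} (hm : 0 < m) (hκ : 0 < κ)
    (hQ : ∀ v, m * ‖v‖ ^ 2 ≤ Q v v) (b : ℝ) :
    ∃ R, 0 ≤ R ∧ ∀ v, κ / 2 * Q v v - L v ≤ b → ‖v‖ ≤ R := by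
  refine ⟨max 1 ((|b| + ‖L‖) / (κ / 2 * m)), le_max_of_le_left zero_le_one, fun v hv => ?_⟩
  by_contra! hlt
  obtain ⟨h1, h2⟩ := max_lt_iff.1 hlt
  rw [div_lt_iff₀ (by positivity)] at h2
  have h3 : L v ≤ ‖L‖ * ‖v‖ := (le_abs_self _).trans (L.le_opNorm v)
  have h4 := mul_le_mul_of_nonneg_left (hQ v) (by positivity : 0 ≤ κ / 2)
  have h5 := le_abs_self b
  have h6 : |b| ≤ |b| * ‖v‖ := le_mul_of_one_le_right (abs_nonneg b) h1.le
  have h7 := mul_lt_mul_of_pos_right h2 (by linarith : 0 < ‖v‖)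
  nlinarith

/-- Coercive quadratic functionals are bounded below. -/
theorem exists_le_quadratic {H : Type*} [NormedAddCommGroup H] [NormedSpace ℝ H]
    {Q : H →L[ℝ] H →L[ℝ] ℝ} (L : H →L[ℝ] ℝ) {m κ : ℝ} (hm : 0 < m) (hκ : 0 < κ)
    (hQ : ∀ v, m * ‖v‖ ^ 2 ≤ Q v v) : ∃ b, ∀ v, b ≤ κ / 2 * Q v v - L v := by
  obtain ⟨R, hR, h⟩ := exists_norm_le_of_quadratic_le L hm hκ hQ 0
  have hn : 0 ≤ ‖L‖ * R := mul_nonneg (norm_nonneg _) hR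
  refine ⟨-(‖L‖ * R), fun v => ?_⟩
  by_cases hv : κ / 2 * Q v v - L v ≤ 0
  · have h1 := mul_le_mul_of_nonneg_left (h v hv) (norm_nonneg L)
    have h2 : L v ≤ ‖L‖ * ‖v‖ := (le_abs_self _).trans (L.le_opNorm v)
    have h3 : 0 ≤ κ / 2 * Q v v :=
      mul_nonneg (by positivity) ((by positivity : 0 ≤ m * ‖v‖ ^ 2).trans (hQ v))
    linarith
  · linarith

/-- Convex quadratic functionals are weakly lower semicontinuous: they lie above their tangents. -/
theorem quadratic_le_of_weak_limit {H : Type*} [NormedAddCommGroup H] [NormedSpace ℝ H]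
    {Q : H →L[ℝ] H →L[ℝ] ℝ} {L : H →L[ℝ] ℝ} {κ c : ℝ} (hκ : 0 < κ) (hQ : ∀ v, 0 ≤ Q v v)
    {ι : Type*} {𝓤 : Filter ι} [𝓤.NeBot] {g : ι → H} {g₀ : H}
    (hweak : ∀ T : H →L[ℝ] ℝ, Tendsto (fun n => T (g n)) 𝓤 (𝓝 (T g₀)))
    (hc : Tendsto (fun n => κ / 2 * Q (g n) (g n) - L (g n)) 𝓤 (𝓝 c)) :
    κ / 2 * Q g₀ g₀ - L g₀ ≤ c := by
  have h1 : Tendsto (fun n => κ / 2 * (Q g₀ (g n) + Q (g n) g₀ - Q g₀ g₀) - L (g n)) 𝓤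
      (𝓝 (κ / 2 * (Q g₀ g₀ + Q g₀ g₀ - Q g₀ g₀) - L g₀)) :=
    ((((hweak (Q g₀)).add (hweak (Q.flip g₀))).sub_const _).const_mul _).sub (hweak L)
  rw [add_sub_cancel_right] at h1
  refine le_of_tendsto_of_tendsto' h1 hc fun n => ?_
  have h2 := hQ (g n - g₀)
  simp only [map_sub, sub_apply] at h2
  have h3 : Q g₀ (g n) + Q (g n) g₀ - Q g₀ g₀ ≤ Q (g n) (g n) := by linarith
  have := mul_le_mul_of_nonneg_left h3 (by positivity : 0 ≤ κ / 2)
  linarith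

end Minimization

theorem propositionp {d N : ℕ} (hd : 1 ≤ d) (Ω : Set (Eu d)) (cell : Fin N → Set (Eu d))
    (hpart : IsLipschitzPartition Ω cell)
    (J : Set (Fin N)) (e : BrokenH Ω cell J → ℝ) (u : BrokenH Ω cell J)
    (he : ContDiffAt ℝ 2 e u)
    (hJ : J = h1Cells (fderiv ℝ e u))
    (hg₀ : ∀ i ∈ J, ∀ w ∈ cellSobolev cell i,
      RepresentsInDistributions (fderiv ℝ e u) i w → RepresentsOnCell (fderiv ℝ e u) i w)
    (m M κ : ℝ) (hm : 0 < m) (hκ : 0 < κ)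
    (hbound : ∀ v w : BrokenH Ω cell J, |fderiv ℝ (fderiv ℝ e) u v w| ≤ M * ‖v‖ * ‖w‖)
    (hcoer : ∀ v : BrokenH Ω cell J, m * ‖v‖ ^ 2 ≤ fderiv ℝ (fderiv ℝ e) u v v) :
    (∀ l ∈ boundaryWeights J, ∃! g : BrokenH Ω cell J,
      IsDegenerateGradient (fderiv ℝ e u) l g) ∧
    ∃ l₀ ∈ boundaryWeights J, IsMinOn (weightCost κ e u) (boundaryWeights J) l₀ := by
  have hex : ∀ l ∈ boundaryWeights J, ∃! g : BrokenH Ω cell J,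
      IsDegenerateGradient (fderiv ℝ e u) l g := by
    intro l hl
    refine existsUnique_of_exists_of_unique ?_ fun g g' h h' => h.unique hpart h'
    refine exists_isDegenerateGradient hpart (fderiv ℝ e u) hl.2 fun i hi => ?_
    have hiJ : i ∈ h1Cells (fderiv ℝ e u) := hJ ▸ hl.2 hi
    obtain ⟨w, hw, hw'⟩ := hiJ
    exact ⟨w, hw, hg₀ i (hl.2 hi) w hw hw'⟩
  refine ⟨hex, ?_⟩
  have hspec : ∀ l ∈ boundaryWeights J, IsDegenerateGradient (fderiv ℝ e u) l
      (degenerateGradient (fderiv ℝ e u) l) := fun l hl => Classical.epsilon_spec (hex l hl).exists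
  have hcost : ∀ l, weightCost κ e u l =
      κ / 2 * fderiv ℝ (fderiv ℝ e) u (degenerateGradient (fderiv ℝ e u) l)
        (degenerateGradient (fderiv ℝ e u) l) -
      fderiv ℝ e u (degenerateGradient (fderiv ℝ e u) l) := fun _ => rfl
  have hbdd : BddBelow (weightCost κ e u '' boundaryWeights J) := by
    obtain ⟨b, hb⟩ := exists_le_quadratic (fderiv ℝ e u) hm hκ hcoer
    refine ⟨b, ?_⟩
    rintro _ ⟨l, -, rfl⟩
    exact hb _
  obtain ⟨c, -, hc, hcmem⟩ := exists_seq_tendsto_sInf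
    (Set.Nonempty.image (weightCost κ e u) ⟨_, top_mem_boundaryWeights hpart J⟩) hbdd
  choose ℓ hℓ hℓc using hcmem
  have : CompleteSpace (BrokenH Ω cell J) := completeSpace_brokenSobolev hpart _ _
  let 𝓤 : Ultrafilter ℕ := hyperfilter ℕ
  have h𝓤 : (𝓤 : Filter ℕ) ≤ atTop := Nat.hyperfilter_le_atTop
  obtain ⟨l₀, hl₀⟩ : ∃ l₀, Tendsto ℓ 𝓤 (𝓝 l₀) := by
    obtain ⟨l₀, -, h⟩ := isCompact_univ.ultrafilter_le_nhds (𝓤.map ℓ) (by simp)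
    exact ⟨l₀, h⟩
  have hlim : Tendsto (fun n => weightCost κ e u (ℓ n)) 𝓤
      (𝓝 (sInf (weightCost κ e u '' boundaryWeights J))) := by
    simp only [hℓc]
    exact hc.mono_left h𝓤
  obtain ⟨R, -, hR⟩ := exists_norm_le_of_quadratic_le (fderiv ℝ e u) hm hκ hcoer
    (sInf (weightCost κ e u '' boundaryWeights J) + 1)
  have hbd : ∀ᶠ n in (𝓤 : Filter ℕ), ‖degenerateGradient (fderiv ℝ e u) (ℓ n)‖ ≤ R := by
    filter_upwards [hlim.eventually_le_const (lt_add_one _)] with n hn using hR _ hn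
  obtain ⟨g₀, hweak⟩ := 𝓤.exists_weak_limit _ hbd
  obtain ⟨hz, hdeg⟩ := isDegenerateGradient_of_limit hpart hJ hg₀ (fun n => hspec _ (hℓ n)) hl₀ hbd
    hweak
  have hmem : l₀ ∈ boundaryWeights J :=
    ⟨isClosed_frontier.mem_of_tendsto hl₀ (.of_forall fun n => (hℓ n).1), hz⟩
  refine ⟨l₀, hmem, fun l hl => ?_⟩
  have hle : weightCost κ e u l₀ ≤ sInf (weightCost κ e u '' boundaryWeights J) := by
    -- By uniqueness the chosen degenerate gradient of the limit weight is the weak limit.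
    rw [hcost, (hspec l₀ hmem).unique hpart hdeg]
    refine quadratic_le_of_weak_limit hκ (fun v => ?_) hweak hlim
    exact (by positivity : 0 ≤ m * ‖v‖ ^ 2).trans (hcoer v)
  exact hle.trans (csInf_le hbdd (mem_image_of_mem _ hl))
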